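/- Consider the plant $\dot x=Ax+Bu+Dw,\ z=Cx+Eu$ with real matrices, $x\in\mathbb R^m,\ u\in\mathbb R^d,\ w\in\mathbb R^n,\ z\in\mathbb R^l$, such that $E^\top[C\ \ E]=[0\ \ R]$ with $R>0$ (i.e. $E^\top C=0$ and $R=E^\top E$ is positive definite), and let $\gamma>0$. For $K\in\mathbb R^{d\times m}$ put $\mathcal T(K)(s)=(C^\top C+K^\top RK)^{1/2}\,(sI-(A-BK))^{-1}D$ and $$\mathcal K=\Big\{K:\ A-BK\ \text{is Hurwitz and}\ \|\mathcal T(K)\|_\infty:=\sup_{\omega\in\mathbb R}\sigma_{\max}\big[\mathcal T(K)(j\omega)\big]<\gamma\Big\}.$$ For $K\in\mathcal K$ let $P_K\ge 0$ be the unique stabilizing solution (the symmetric positive semidefinite solution for which $A-BK+\gamma^{-2}DD^\top P_K$ is Hurwitz) of $$(A-BK)^\top P+P(A-BK)+C^\top C+K^\top RK+\gamma^{-2}PDD^\top P=0,$$ and let $\mathcal J(K)=\operatorname{tr}(P_KDD^\top)$. The continuous-time mixed $\mathcal H_2/\mathcal H_\infty$ design problem is to minimize $\mathcal J$ over $\mathcal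 K$. A stationary point is a $K\in\mathcal K$ with $\nabla\mathcal J(K)=0$. Suppose that this problem admits a global minimizer in $\mathcal K$ and that $(A,C)$ is detectable. Then $\mathcal J$ is differentiable at every point of $\mathcal K$ (so that stationary points make sense), and: 1. there is a global minimizer $K^*\in\mathcal K$ of $\mathcal J$ over $\mathcal K$ with $K^*=R^{-1}B^\top P_{K^*}$; 2. if $K\in\mathcal K$ is a stationary point of $\mathcal J$ at which the pair $(A-BK+\gamma^{-2}DD^\top P_K,\ D)$ is controllable, then $K$ is the unique stationary point of $\mathcal J$ in $\mathcal K$ and the unique global minimizer of $\mathcal J$ over $\mathcal K$, and $K=R^{-1}B^\top P_K$. -/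

import Mathlib

open scoped Matrix

noncomputable section

namespace MixedDesign

/-- A real square matrix is Hurwitz if all its complex eigenvalues have negative real part. -/
def IsHurwitz {m : ℕ} (M : Matrix (Fin m) (Fin m) ℝ) : Prop :=
  ∀ z ∈ spectrum ℂ (M.map ((↑) : ℝ → ℂ)), z.re < 0

/-- The pair `(A, C)` is detectable: some output injection makes `A + L C` Hurwitz. -/
def IsDetectable {m l : ℕ} (A : Matrix (Fin m) (Fin m) ℝ) (C : Matrix (Fin l) (Fin m) ℝ) : Prop :=
  ∃ L : Matrix (Fin m) (Fin l) ℝ, IsHurwitz (A + L * C)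

/-- The controllability matrix `[B, A B, …, A^(m-1) B]` of the pair `(A, B)`;
its columns are indexed by the power of `A` and the column of `B`. -/
def controllabilityMatrix {m n : ℕ} (A : Matrix (Fin m) (Fin m) ℝ)
    (B : Matrix (Fin m) (Fin n) ℝ) : Matrix (Fin m) (Fin m × Fin n) ℝ :=
  Matrix.of fun i kj => (A ^ (kj.1 : ℕ) * B) i kj.2

/-- The pair `(A, B)` is controllable: its controllability matrix has full row rank. -/
def IsControllable {m n : ℕ} (A : Matrix (Fin m) (Fin m) ℝ) (B : Matrix (Fin m) (Fin n) ℝ) :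
    Prop :=
  (controllabilityMatrix A B).rank = m

/-- The value at `s ∈ ℂ` of the transfer function `C (s I - A)⁻¹ B` of the real state-space
system `ẋ = A x + B w`, `z = C x`. -/
def transferFunction {m n p : ℕ} (A : Matrix (Fin m) (Fin m) ℝ) (B : Matrix (Fin m) (Fin n) ℝ)
    (C : Matrix (Fin p) (Fin m) ℝ) (s : ℂ) : Matrix (Fin p) (Fin n) ℂ :=
  C.map ((↑) : ℝ → ℂ) *
    (s • (1 : Matrix (Fin m) (Fin m) ℂ) - A.map ((↑) : ℝ → ℂ))⁻¹ * B.map ((↑) : ℝ → ℂ)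

open scoped Matrix.Norms.L2Operator in
/-- The `H∞` norm `sup_ω σ_max(G(jω))` of a continuous-time transfer function, as an extended
nonnegative number. The largest singular value is the operator norm for the Euclidean norms. -/
def hInfNorm {p n : ℕ} (G : ℂ → Matrix (Fin p) (Fin n) ℂ) : ENNReal :=
  ⨆ ω : ℝ, ENNReal.ofReal ‖G (Complex.I * (ω : ℂ))‖

/-- The matrices of the plant `ẋ = A x + B u + D w`, `z = C x + E u`, with state in `ℝ^m`,
control in `ℝ^d`, disturbance in `ℝ^n` and controlled output in `ℝ^l`. -/
structure Plant (m d n l : ℕ) where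
  A : Matrix (Fin m) (Fin m) ℝ
  B : Matrix (Fin m) (Fin d) ℝ
  C : Matrix (Fin l) (Fin m) ℝ
  D : Matrix (Fin m) (Fin n) ℝ
  E : Matrix (Fin l) (Fin d) ℝ

namespace Plant

variable {m d n l : ℕ} (S : Plant m d n l)

/-- The control weight `R = Eᵀ E`. -/
def R : Matrix (Fin d) (Fin d) ℝ := S.Eᵀ * S.E

/-- The standing assumption `Eᵀ [C  E] = [0  R]` with `R > 0`. -/
def IsNormalized : Prop := S.Eᵀ * S.C = 0 ∧ S.R.PosDef

/-- The closed-loop state matrix `A - B K` under `u = -K x`. -/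
def closedLoop (K : Matrix (Fin d) (Fin m) ℝ) : Matrix (Fin m) (Fin m) ℝ := S.A - S.B * K

open scoped MatrixOrder in
/-- The output matrix `(Cᵀ C + Kᵀ R K)^(1/2)` (positive semidefinite square root). -/
def outputSqrt (K : Matrix (Fin d) (Fin m) ℝ) : Matrix (Fin m) (Fin m) ℝ :=
  CFC.sqrt (S.Cᵀ * S.C + Kᵀ * S.R * K)

/-- The closed-loop transfer function
`𝒯(K)(s) = (Cᵀ C + Kᵀ R K)^(1/2) (s I - (A - B K))⁻¹ D`. -/
def closedLoopTransfer (K : Matrix (Fin d) (Fin m) ℝ) : ℂ → Matrix (Fin m) (Fin n) ℂ :=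
  transferFunction (S.closedLoop K) S.D (S.outputSqrt K)

/-- The feasible set `𝒦` of gains with `A - B K` Hurwitz and `‖𝒯(K)‖_∞ < γ`. -/
def feasible (γ : ℝ) : Set (Matrix (Fin d) (Fin m) ℝ) :=
  {K | IsHurwitz (S.closedLoop K) ∧ hInfNorm (S.closedLoopTransfer K) < ENNReal.ofReal γ}

/-- The matrix `A - B K + γ⁻² D Dᵀ P`. -/
def worstCaseLoop (γ : ℝ) (K : Matrix (Fin d) (Fin m) ℝ) (P : Matrix (Fin m) (Fin m) ℝ) :
    Matrix (Fin m) (Fin m) ℝ :=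
  S.closedLoop K + (γ⁻¹ ^ 2) • (S.D * S.Dᵀ * P)

/-- `P` is a stabilizing solution, symmetric positive semidefinite, of the Riccati equation
`(A - BK)ᵀ P + P (A - BK) + Cᵀ C + Kᵀ R K + γ⁻² P D Dᵀ P = 0`. -/
structure IsStabilizingSolution (γ : ℝ) (K : Matrix (Fin d) (Fin m) ℝ)
    (P : Matrix (Fin m) (Fin m) ℝ) : Prop where
  posSemidef : P.PosSemidef
  riccati : (S.closedLoop K)ᵀ * P + P * S.closedLoop K + S.Cᵀ * S.C + Kᵀ * S.R * K +
    (γ⁻¹ ^ 2) • (P * S.D * S.Dᵀ * P) = 0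
  hurwitz : IsHurwitz (S.worstCaseLoop γ K P)

open Classical in
/-- The stabilizing solution `P_K` of the Riccati equation (and `0` where there is none). It is
unique, see `IsStabilizingSolution.unique`. -/
def riccatiSolution (γ : ℝ) (K : Matrix (Fin d) (Fin m) ℝ) : Matrix (Fin m) (Fin m) ℝ :=
  if h : ∃ P, S.IsStabilizingSolution γ K P then h.choose else 0

/-- The cost `𝒥(K) = tr(P_K D Dᵀ)`. -/
def cost (γ : ℝ) (K : Matrix (Fin d) (Fin m) ℝ) : ℝ :=
  (S.riccatiSolution γ K * S.D * S.Dᵀ).trace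

/-- `K` is a global minimizer of the cost over the feasible set. -/
def IsGlobalMinimizer (γ : ℝ) (K : Matrix (Fin d) (Fin m) ℝ) : Prop :=
  K ∈ S.feasible γ ∧ ∀ K' ∈ S.feasible γ, S.cost γ K ≤ S.cost γ K'

/-- The policy gradient `∇𝒥(K)`, the matrix of partial derivatives of the cost with respect to
the entries of `K`. -/
def policyGradient (γ : ℝ) (K : Matrix (Fin d) (Fin m) ℝ) : Matrix (Fin d) (Fin m) ℝ :=
  Matrix.of fun i j => fderiv ℝ (S.cost γ) K (Matrix.single i j 1)

/-- `K` is a stationary point of the cost: a feasible gain at which the cost is differentiable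
and its gradient vanishes. -/
def IsStationary (γ : ℝ) (K : Matrix (Fin d) (Fin m) ℝ) : Prop :=
  K ∈ S.feasible γ ∧ DifferentiableAt ℝ (S.cost γ) K ∧ S.policyGradient γ K = 0

end Plant

/-- A Sylvester equation `F₁ᵀ X + X F₂ = 0` with Hurwitz coefficients has only the zero
solution. -/
theorem sylvester_eq_zero {m : ℕ} {F₁ F₂ X : Matrix (Fin m) (Fin m) ℝ} (h₁ : IsHurwitz F₁)
    (h₂ : IsHurwitz F₂) (h : F₁ᵀ * X + X * F₂ = 0) : X = 0 := by
  have key : (X.map ((↑) : ℝ → ℂ)) = 0 := by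
    set f : Matrix (Fin m) (Fin m) ℝ →+* Matrix (Fin m) (Fin m) ℂ := Complex.ofRealHom.mapMatrix
      with hf
    have hc : f F₁ᵀ * f X = f X * (-(f F₂)) := by
      rw [mul_neg, ← map_mul, ← map_mul, eq_neg_iff_add_eq_zero, ← map_add, h, map_zero]
    have hp : ∀ p : Polynomial ℂ,
        Polynomial.aeval (f F₁ᵀ) p * f X = f X * Polynomial.aeval (-(f F₂)) p := by
      intro p
      have hs : SemiconjBy (f X) (-(f F₂)) (f F₁ᵀ) := hc.symm
      induction p using Polynomial.induction_on' with
      | add p q hp hq => simp only [map_add, add_mul, mul_add, hp, hq]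
      | monomial k a =>
        have := (hs.pow_right k).eq
        simp only [Polynomial.aeval_monomial, Algebra.algebraMap_eq_smul_one, smul_mul_assoc,
          one_mul, mul_smul_comm]
        rw [this]
    have hT : f F₁ᵀ = (f F₁)ᵀ := by ext; simp [hf]
    have hu : IsUnit (Polynomial.aeval (-(f F₂)) (f F₁).charpoly) := by
      rcases Nat.eq_zero_or_pos m with rfl | hm
      · exact isUnit_of_subsingleton _
      have : Nonempty (Fin m) := ⟨⟨0, hm⟩⟩
      by_contra hnu
      have h0 : (0 : ℂ) ∈ spectrum ℂ (Polynomial.aeval (-(f F₂)) (f F₁).charpoly) := by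
        rwa [spectrum.zero_mem_iff]
      rw [spectrum.map_polynomial_aeval_of_nonempty _ _
        (spectrum.nonempty_of_isAlgClosed_of_finiteDimensional ℂ _)] at h0
      obtain ⟨z, hz, hz0⟩ := h0
      have hz1 : z ∈ spectrum ℂ (f F₁) := by
        rw [Matrix.mem_spectrum_iff_isRoot_charpoly]
        exact hz0
      have hz2 : -z ∈ spectrum ℂ (f F₂) := by
        have := hz
        rw [← spectrum.neg_eq] at this
        simpa using this
      have a1 := h₁ z hz1
      have a2 := h₂ (-z) hz2
      simp at a2
      linarith
    have h3 := hp (f F₁).charpoly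
    have h4 := Matrix.aeval_self_charpoly (f F₁)ᵀ
    rw [Matrix.charpoly_transpose] at h4
    rw [hT, h4, zero_mul] at h3
    exact (hu.mul_left_eq_zero).1 h3.symm
  ext i j
  simpa using congrFun (congrFun key i) j

/-- The stabilizing solution of the Riccati equation is unique. -/
theorem Plant.IsStabilizingSolution.unique {m d n l : ℕ} {S : Plant m d n l} {γ : ℝ}
    {K : Matrix (Fin d) (Fin m) ℝ} {P Q : Matrix (Fin m) (Fin m) ℝ}
    (hP : S.IsStabilizingSolution γ K P) (hQ : S.IsStabilizingSolution γ K Q) : P = Q := by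
  have hPt : Pᵀ = P := by simpa using hP.posSemidef.isHermitian.eq
  refine sub_eq_zero.1 (sylvester_eq_zero hP.hurwitz hQ.hurwitz ?_)
  have e := congrArg₂ (· - ·) hP.riccati hQ.riccati
  simp only [sub_zero] at e
  rw [← e]
  simp only [Plant.worstCaseLoop, Matrix.transpose_add, Matrix.transpose_smul,
    Matrix.transpose_mul, Matrix.transpose_transpose, hPt]
  simp only [add_mul, mul_add, mul_sub, sub_mul, smul_mul_assoc, mul_smul_comm, Matrix.mul_assoc,
    smul_sub]
  abel

end MixedDesign

end

noncomputable section

namespace MixedDesign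

/-! ### Real quadratic forms and their positivity. -/

section RealForms

variable {ι κ : Type*} [Fintype ι] [Fintype κ]

/-! Write `G = R K - Bᵀ P_K`, and let `F` be the worst-case loop `A - B K + γ⁻² D Dᵀ P_K`. A strict
bounded real lemma (`exists_kyp`, by convex duality; converse `frequency_le_of_kyp`) certifies
feasibility by a strict matrix inequality. Hence `𝒦` is open, and Newton's iteration from `0`
produces `P_K` (`exists_stabilizing_of_riccati_lt`). The linearized Riccati equation is a Lyapunov
equation in the Hurwitz matrix `F`, so the implicit function theorem makes `P_K` differentiable.
Pairing its derivative with the Gramian `Λ` of `(F, D)` gives the derivative `2 tr(Hᵀ G Λ)` of the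
cost in direction `H`. Stationarity is thus `G Λ = 0`, which yields `G F^j D = 0` for all `j`
(`IsStationary.gradient_annihilates`).

Existence of a fixed point is policy iteration from a minimizer `K`, with `K' = R⁻¹ Bᵀ P_K`.
Completing the square makes `P_K` a Riccati supersolution for `K'`. Detectability makes `A - B K'`
Hurwitz, and stationarity makes `K'` agree with `K` on the controllable subspace, so `K'` is
feasible. Comparison gives `P_{K'} ≤ P_K`, so `K'` is again a minimizer
(`IsGlobalMinimizer.improve`). The solutions decrease to a limit `L` with limiting gain `K*`,
feasible for the same two reasons. A priori `L` might not be stabilizing, but `L ≥ P_{K*}`, and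
minimality forces `(L - P_{K*}) D = 0`; the difference then solves a homogeneous Sylvester equation
and vanishes.

For uniqueness, controllability of `(F, D)` turns `G F^j D = 0` into `G = 0`. If `K'` is another
stationary point, subtracting the Riccati equations shows that `P_{K'}` and `P_K` agree on the
controllable subspace of `(F', D)`; so do the gains, hence the orbits `F'^j D` and `F^j D` coincide.
The latter span the space, so `K' = K` (`IsStationary.eq_of_isControllable`). A global minimizer
exists and is stationary, so it is `K`. -/

theorem posSemidef_real_iff {N : Matrix ι ι ℝ} :
    N.PosSemidef ↔ Nᵀ = N ∧ ∀ x, 0 ≤ x ⬝ᵥ N *ᵥ x := by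
  rw [Matrix.posSemidef_iff_dotProduct_mulVec, Matrix.IsHermitian,
    Matrix.conjTranspose_eq_transpose_of_trivial]
  simp

theorem posDef_real_iff {N : Matrix ι ι ℝ} :
    N.PosDef ↔ Nᵀ = N ∧ ∀ x, x ≠ 0 → 0 < x ⬝ᵥ N *ᵥ x := by
  rw [Matrix.posDef_iff_dotProduct_mulVec, Matrix.IsHermitian,
    Matrix.conjTranspose_eq_transpose_of_trivial]
  simp

theorem dotProduct_mulVec_transpose (N : Matrix ι κ ℝ) (x : ι → ℝ) (y : κ → ℝ) :
    x ⬝ᵥ N *ᵥ y = (Nᵀ *ᵥ x) ⬝ᵥ y := by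
  rw [Matrix.dotProduct_mulVec, Matrix.mulVec_transpose]

theorem dotProduct_mulVec_comm_of_symm {N : Matrix ι ι ℝ} (hN : Nᵀ = N) (x y : ι → ℝ) :
    x ⬝ᵥ N *ᵥ y = y ⬝ᵥ N *ᵥ x := by
  rw [dotProduct_mulVec_transpose, hN, dotProduct_comm]

/-- A positive semidefinite form vanishes only on the kernel. -/
theorem mulVec_eq_zero_of_form_eq_zero {N : Matrix ι ι ℝ} (hN : N.PosSemidef) {x : ι → ℝ}
    (hx : x ⬝ᵥ N *ᵥ x = 0) : N *ᵥ x = 0 := by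
  have := (hN.dotProduct_mulVec_zero_iff x).1 (by simpa using hx)
  exact this

/-- The matrices, not necessarily symmetric, whose quadratic form is positive. -/
def IsPosForm (N : Matrix ι ι ℝ) : Prop := ∀ x, x ≠ 0 → 0 < x ⬝ᵥ N *ᵥ x

theorem isPosForm_one [DecidableEq ι] : IsPosForm (1 : Matrix ι ι ℝ) := fun x hx => by
  rw [Matrix.one_mulVec]
  exact lt_of_le_of_ne (Finset.sum_nonneg fun i _ => mul_self_nonneg _)
    (Ne.symm fun h => hx (dotProduct_self_eq_zero.1 h))

/-- By homogeneity only the unit sphere has to be tested, and its compactness makes the strict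
inequality stable in `N`. -/
theorem isOpen_isPosForm : IsOpen {N : Matrix ι ι ℝ | IsPosForm N} := by
  classical
  have hK : IsCompact (Metric.sphere (0 : ι → ℝ) 1) := isCompact_sphere _ _
  have : {N : Matrix ι ι ℝ | IsPosForm N} =
      {N | ∀ x ∈ Metric.sphere (0 : ι → ℝ) 1, 0 < x ⬝ᵥ N *ᵥ x} := by
    ext N
    refine ⟨fun h x hx => h x ?_, fun h x hx => ?_⟩
    · rintro rfl
      simp at hx
    · have hn : 0 < ‖x‖ := norm_pos_iff.2 hx
      have := h (‖x‖⁻¹ • x) (by simp [norm_smul, hn.ne'])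
      rw [Matrix.mulVec_smul, smul_dotProduct, dotProduct_smul, smul_eq_mul, smul_eq_mul] at this
      have h2 : 0 < ‖x‖⁻¹ := inv_pos.2 hn
      exact (mul_pos_iff_of_pos_left h2).1 ((mul_pos_iff_of_pos_left h2).1 this)
  rw [this]
  refine isOpen_iff_eventually.2 fun N hN => ?_
  refine hK.eventually_forall_of_forall_eventually fun x hx => ?_
  have hc : Continuous fun p : Matrix ι ι ℝ × (ι → ℝ) => p.2 ⬝ᵥ p.1 *ᵥ p.2 := by fun_prop
  exact hc.continuousAt.eventually (lt_mem_nhds (hN x hx))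

theorem convex_isPosForm : Convex ℝ {N : Matrix ι ι ℝ | IsPosForm N} := by
  intro N hN N' hN' a b ha hb hab x hx
  have h1 := hN x hx
  have h2 := hN' x hx
  rw [Matrix.add_mulVec, Matrix.smul_mulVec, Matrix.smul_mulVec, dotProduct_add,
    dotProduct_smul, dotProduct_smul, smul_eq_mul, smul_eq_mul]
  rcases ha.lt_or_eq with ha | rfl
  · nlinarith [mul_pos ha h1, mul_nonneg hb h2.le]
  · have : b = 1 := by linarith
    simp [this, h2]

/-- Openness allows a small multiple of the identity to be subtracted. -/
theorem IsPosForm.exists_lower_bound [DecidableEq ι] {N : Matrix ι ι ℝ} (hN : IsPosForm N) :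
    ∃ ε : ℝ, 0 < ε ∧ ∀ x, ε * (x ⬝ᵥ x) ≤ x ⬝ᵥ N *ᵥ x := by
  have hc : ContinuousAt (fun ε : ℝ => N - ε • (1 : Matrix ι ι ℝ)) 0 := by fun_prop
  have := hc.eventually (isOpen_isPosForm.mem_nhds (by simpa using hN))
  obtain ⟨ε, h, hε⟩ := ((this.filter_mono nhdsWithin_le_nhds).and
    (self_mem_nhdsWithin : Set.Ioi (0 : ℝ) ∈ nhdsWithin 0 (Set.Ioi 0))).exists
  refine ⟨ε, hε, fun x => ?_⟩
  rcases eq_or_ne x 0 with rfl | hx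
  · simp
  · have := h x hx
    rw [Matrix.sub_mulVec, Matrix.smul_mulVec, Matrix.one_mulVec, dotProduct_sub,
      dotProduct_smul, smul_eq_mul] at this
    linarith

end RealForms

/-! ### Hurwitz matrices, Lyapunov and Sylvester equations. -/

section Hurwitz

variable {m : ℕ}

theorem mem_spectrum_iff_exists_mulVec {M : Matrix (Fin m) (Fin m) ℂ} {z : ℂ} :
    z ∈ spectrum ℂ M ↔ ∃ v, v ≠ 0 ∧ M *ᵥ v = z • v := by
  rw [spectrum.mem_iff, Matrix.isUnit_iff_isUnit_det, isUnit_iff_ne_zero, not_not,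
    ← Matrix.exists_mulVec_eq_zero_iff]
  refine exists_congr fun v => and_congr_right fun _ => ?_
  rw [Matrix.sub_mulVec, Algebra.algebraMap_eq_smul_one, Matrix.smul_mulVec, Matrix.one_mulVec,
    sub_eq_zero, eq_comm]

theorem map_ofReal_mulVec {ι κ : Type*} [Fintype κ] (M : Matrix ι κ ℝ) (v : κ → ℂ) (i : ι) :
    (M.map ((↑) : ℝ → ℂ) *ᵥ v) i =
      ⟨(M *ᵥ fun j => (v j).re) i, (M *ᵥ fun j => (v j).im) i⟩ := by
  apply Complex.ext <;> simp [Matrix.mulVec, dotProduct]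

/-- Hurwitz matrices in terms of real and imaginary parts of eigenvectors. -/
theorem isHurwitz_iff {F : Matrix (Fin m) (Fin m) ℝ} :
    IsHurwitz F ↔ ∀ (α β : ℝ) (a b : Fin m → ℝ), 0 ≤ α → F *ᵥ a = α • a - β • b →
      F *ᵥ b = β • a + α • b → a = 0 ∧ b = 0 := by
  constructor
  · intro h α β a b hα ha hb
    by_contra hab
    have : (⟨α, β⟩ : ℂ) ∈ spectrum ℂ (F.map ((↑) : ℝ → ℂ)) := by
      rw [mem_spectrum_iff_exists_mulVec]
      refine ⟨fun i => ⟨a i, b i⟩, fun h0 => hab ⟨?_, ?_⟩, ?_⟩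
      · ext i
        simpa using congrArg Complex.re (congrFun h0 i)
      · ext i
        simpa using congrArg Complex.im (congrFun h0 i)
      · ext i
        rw [map_ofReal_mulVec]
        simp only [ha, hb]
        apply Complex.ext <;> simp
        ring
    exact absurd (h _ this) (not_lt.2 hα)
  · intro h z hz
    by_contra hre
    rw [mem_spectrum_iff_exists_mulVec] at hz
    obtain ⟨v, hv, hvz⟩ := hz
    have hi := fun i => congrFun hvz i
    simp only [map_ofReal_mulVec] at hi
    obtain ⟨h1, h2⟩ := h z.re z.im (fun j => (v j).re) (fun j => (v j).im) (not_lt.1 hre)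
      (by ext i; simpa using congrArg Complex.re (hi i))
      (by ext i; simpa [add_comm] using congrArg Complex.im (hi i))
    apply hv
    ext i
    exact Complex.ext (congrFun h1 i) (congrFun h2 i)

theorem IsHurwitz.transpose {F : Matrix (Fin m) (Fin m) ℝ} (h : IsHurwitz F) : IsHurwitz Fᵀ := by
  intro z hz
  refine h z ?_
  rw [Matrix.mem_spectrum_iff_isRoot_charpoly] at hz ⊢
  rwa [Matrix.transpose_map, Matrix.charpoly_transpose] at hz

/-- Powers of a complex matrix with spectrum in the open unit disc tend to zero. -/
theorem tendsto_pow_mulVec_zero {G : Matrix (Fin m) (Fin m) ℂ}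
    (h : ∀ z ∈ spectrum ℂ G, ‖z‖ < 1) (v : Fin m → ℂ) :
    Filter.Tendsto (fun k : ℕ => G ^ k *ᵥ v) Filter.atTop (nhds 0) := by
  open scoped Matrix.Norms.L2Operator in
  rcases Nat.eq_zero_or_pos m with rfl | hm
  · convert tendsto_const_nhds
  have : Nonempty (Fin m) := ⟨⟨0, hm⟩⟩
  have hr : spectralRadius ℂ G < ((1 : NNReal) : ENNReal) :=
    spectrum.spectralRadius_lt_of_forall_lt G fun z hz => by
      have := h z hz
      rwa [← NNReal.coe_lt_coe]
  obtain ⟨r, hr1, hr2⟩ := ENNReal.lt_iff_exists_nnreal_btwn.1 hr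
  have hr2' : r < 1 := by exact_mod_cast hr2
  -- Gelfand's formula, with `r` strictly between the spectral radius and `1`.
  have hG := spectrum.pow_nnnorm_pow_one_div_tendsto_nhds_spectralRadius G
  have hev : ∀ᶠ k : ℕ in Filter.atTop, ‖G ^ k‖ ≤ (r : ℝ) ^ k := by
    filter_upwards [hG.eventually (gt_mem_nhds hr1), Filter.eventually_gt_atTop 0] with k hk hk0
    have hk' : (0 : ℝ) < k := by exact_mod_cast hk0
    have h1 : ((‖G ^ k‖₊ : ENNReal) ^ (1 / k : ℝ)) ^ (k : ℝ) ≤ (r : ENNReal) ^ (k : ℝ) :=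
      ENNReal.rpow_le_rpow hk.le hk'.le
    rw [← ENNReal.rpow_mul, one_div, inv_mul_cancel₀ hk'.ne', ENNReal.rpow_one,
      ENNReal.rpow_natCast] at h1
    exact_mod_cast h1
  have h0 : Filter.Tendsto (fun k : ℕ => G ^ k) Filter.atTop (nhds 0) :=
    squeeze_zero_norm' hev (tendsto_pow_atTop_nhds_zero_of_lt_one r.2 (by exact_mod_cast hr2'))
  have hc : Continuous fun N : Matrix (Fin m) (Fin m) ℂ => N *ᵥ v := by fun_prop
  have h1 := (hc.tendsto 0).comp h0
  rw [Matrix.zero_mulVec] at h1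
  exact h1

theorem IsHurwitz.isUnit_one_sub {F : Matrix (Fin m) (Fin m) ℝ} (h : IsHurwitz F) :
    IsUnit (1 - F).det := by
  rw [isUnit_iff_ne_zero]
  intro h0
  obtain ⟨v, hv, hv0⟩ := Matrix.exists_mulVec_eq_zero_iff.2 h0
  rw [Matrix.sub_mulVec, Matrix.one_mulVec, sub_eq_zero] at hv0
  exact hv (isHurwitz_iff.1 h 1 0 v 0 zero_le_one (by simp [← hv0]) (by simp)).1

/-- The Cayley transform of a Hurwitz matrix has all its eigenvalues in the open unit disc. -/
theorem IsHurwitz.norm_lt_one_of_mem_spectrum_cayley {F : Matrix (Fin m) (Fin m) ℝ}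
    (h : IsHurwitz F) {z : ℂ}
    (hz : z ∈ spectrum ℂ (((1 + F) * (1 - F)⁻¹).map ((↑) : ℝ → ℂ))) : ‖z‖ < 1 := by
  obtain ⟨v, hv, hvz⟩ := mem_spectrum_iff_exists_mulVec.1 hz
  set f : Matrix (Fin m) (Fin m) ℝ →+* Matrix (Fin m) (Fin m) ℂ := Complex.ofRealHom.mapMatrix
  change f _ *ᵥ v = _ at hvz
  have h1 : f (1 - F) * f (1 - F)⁻¹ = 1 := by
    rw [← map_mul, Matrix.mul_nonsing_inv _ h.isUnit_one_sub, map_one]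
  set y := f (1 - F)⁻¹ *ᵥ v with hy
  have hvy : v = f (1 - F) *ᵥ y := by rw [hy, Matrix.mulVec_mulVec, h1, Matrix.one_mulVec]
  have hy0 : y ≠ 0 := fun h0 => hv (by rw [hvy, h0, Matrix.mulVec_zero])
  rw [map_mul, ← Matrix.mulVec_mulVec, ← hy, hvy] at hvz
  simp only [map_add, map_sub, map_one, Matrix.add_mulVec, Matrix.sub_mulVec,
    Matrix.one_mulVec] at hvz
  -- For `z ≠ -1` this makes `(z - 1) / (z + 1)` an eigenvalue of `F`; its real part has the sign of
  -- `|z|² - 1`.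
  have hFy : (z + 1) • (f F *ᵥ y) = (z - 1) • y := by
    have : f F *ᵥ y = z • (y - f F *ᵥ y) - y := by rw [← hvz]; abel
    rw [add_smul, one_smul]
    nth_rw 2 [this]
    rw [smul_sub, sub_smul, one_smul]
    abel
  by_contra hz1
  have hn : (1 : ℝ) ≤ Complex.normSq z := by
    rw [Complex.normSq_eq_norm_sq]
    nlinarith [not_lt.1 hz1]
  rcases eq_or_ne (z + 1) 0 with h0 | h0
  · rw [h0, zero_smul] at hFy
    rcases smul_eq_zero.1 hFy.symm with h2 | h2
    · have : (2 : ℂ) = 0 := by linear_combination h0 - h2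
      norm_num at this
    · exact hy0 h2
  · have hs : ((z - 1) / (z + 1)) ∈ spectrum ℂ (F.map ((↑) : ℝ → ℂ)) := by
      refine mem_spectrum_iff_exists_mulVec.2 ⟨y, hy0, ?_⟩
      change f F *ᵥ y = _
      rw [div_eq_inv_mul, mul_smul, ← hFy, smul_smul, inv_mul_cancel₀ h0, one_smul]
    have hre := h _ hs
    rw [Complex.div_re, ← add_div, div_lt_iff₀ (Complex.normSq_pos.2 h0)] at hre
    simp only [Complex.normSq_apply] at hn
    simp at hre
    nlinarith

/-- The solution of a Lyapunov equation with Hurwitz coefficient and nonnegative right-hand side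
has a nonnegative quadratic form. -/
theorem IsHurwitz.lyapunov_nonneg {F X Q : Matrix (Fin m) (Fin m) ℝ} (hF : IsHurwitz F)
    (hQ : ∀ x, 0 ≤ x ⬝ᵥ Q *ᵥ x) (h : Fᵀ * X + X * F + Q = 0) (x : Fin m → ℝ) :
    0 ≤ x ⬝ᵥ X *ᵥ x := by
  set G := (1 + F) * (1 - F)⁻¹ with hG
  -- The iterates of `G` play the role of the flow `exp(tF)`: the form of `X` decreases along them,
  -- and they tend to zero. With `x = y - F y` and `G x = y + F y`, the drop is `2 yᵀ Q y`.
  have hstep : ∀ x, (G *ᵥ x) ⬝ᵥ X *ᵥ (G *ᵥ x) ≤ x ⬝ᵥ X *ᵥ x := by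
    intro x
    set y := (1 - F)⁻¹ *ᵥ x with hy
    have hx : x = y - F *ᵥ y := by
      have : y - F *ᵥ y = (1 - F) *ᵥ y := by rw [Matrix.sub_mulVec, Matrix.one_mulVec]
      rw [this, hy, Matrix.mulVec_mulVec, Matrix.mul_nonsing_inv _ hF.isUnit_one_sub,
        Matrix.one_mulVec]
    have hGx : G *ᵥ x = y + F *ᵥ y := by
      rw [hG, ← Matrix.mulVec_mulVec, ← hy, Matrix.add_mulVec, Matrix.one_mulVec]
    have hl : (F *ᵥ y) ⬝ᵥ X *ᵥ y + y ⬝ᵥ X *ᵥ (F *ᵥ y) + y ⬝ᵥ Q *ᵥ y = 0 := by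
      have := congrArg (fun N => y ⬝ᵥ N *ᵥ y) h
      simp only [Matrix.add_mulVec, dotProduct_add, ← Matrix.mulVec_mulVec, Matrix.zero_mulVec,
        dotProduct_zero] at this
      rwa [dotProduct_mulVec_transpose, Matrix.transpose_transpose] at this
    rw [hGx, hx]
    simp only [Matrix.mulVec_add, Matrix.mulVec_sub, dotProduct_add, dotProduct_sub,
      add_dotProduct, sub_dotProduct]
    linarith [hQ y]
  have hpow : ∀ k : ℕ, (G ^ k *ᵥ x) ⬝ᵥ X *ᵥ (G ^ k *ᵥ x) ≤ x ⬝ᵥ X *ᵥ x := by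
    intro k
    induction k with
    | zero => simp
    | succ k ih =>
      refine le_trans ?_ ih
      rw [pow_succ', ← Matrix.mulVec_mulVec]
      exact hstep _
  have h0 : Filter.Tendsto (fun k : ℕ => G ^ k *ᵥ x) Filter.atTop (nhds 0) := by
    have h1 := tendsto_pow_mulVec_zero (fun z hz => hF.norm_lt_one_of_mem_spectrum_cayley hz)
      (fun i => (x i : ℂ))
    rw [tendsto_pi_nhds] at h1 ⊢
    intro i
    have h2 := (Complex.continuous_re.tendsto _).comp (h1 i)
    refine h2.congr fun k => ?_
    have : (((1 + F) * (1 - F)⁻¹).map ((↑) : ℝ → ℂ)) ^ k = (G ^ k).map ((↑) : ℝ → ℂ) :=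
      (map_pow (Complex.ofRealHom.mapMatrix) G k).symm
    simp only [Function.comp, this, map_ofReal_mulVec, Complex.ofReal_re]
  have hc : Continuous fun v : Fin m → ℝ => v ⬝ᵥ X *ᵥ v := by fun_prop
  have h1 := (hc.tendsto 0).comp h0
  rw [zero_dotProduct] at h1
  exact le_of_tendsto' h1 hpow

theorem lyapunov_unique {F X Y Q : Matrix (Fin m) (Fin m) ℝ} (hF : IsHurwitz F)
    (hX : Fᵀ * X + X * F + Q = 0) (hY : Fᵀ * Y + Y * F + Q = 0) : X = Y := by
  refine sub_eq_zero.1 (sylvester_eq_zero hF hF ?_)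
  rw [mul_sub, sub_mul, ← sub_eq_zero.2 (hX.trans hY.symm)]
  abel

theorem lyapunov_transpose_eq {F X Q : Matrix (Fin m) (Fin m) ℝ} (hF : IsHurwitz F) (hQ : Qᵀ = Q)
    (h : Fᵀ * X + X * F + Q = 0) : Xᵀ = X := by
  refine lyapunov_unique hF ?_ h
  have := congrArg Matrix.transpose h
  simp only [Matrix.transpose_add, Matrix.transpose_mul, Matrix.transpose_transpose, hQ,
    Matrix.transpose_zero] at this
  rwa [add_comm (Xᵀ * F)] at this

theorem lyapunov_posSemidef {F X Q : Matrix (Fin m) (Fin m) ℝ} (hF : IsHurwitz F)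
    (hQ : Q.PosSemidef) (h : Fᵀ * X + X * F + Q = 0) : X.PosSemidef := by
  obtain ⟨hs, hn⟩ := posSemidef_real_iff.1 hQ
  exact posSemidef_real_iff.2 ⟨lyapunov_transpose_eq hF hs h, hF.lyapunov_nonneg hn h⟩

/-- The Sylvester operator `X ↦ F₁ᵀ X + X F₂`. -/
def sylvesterMap (F₁ F₂ : Matrix (Fin m) (Fin m) ℝ) :
    Matrix (Fin m) (Fin m) ℝ →ₗ[ℝ] Matrix (Fin m) (Fin m) ℝ where
  toFun X := F₁ᵀ * X + X * F₂
  map_add' X Y := by rw [mul_add, add_mul]; abel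
  map_smul' c X := by simp

theorem sylvesterMap_injective {F₁ F₂ : Matrix (Fin m) (Fin m) ℝ} (h₁ : IsHurwitz F₁)
    (h₂ : IsHurwitz F₂) : Function.Injective (sylvesterMap F₁ F₂) :=
  (injective_iff_map_eq_zero _).2 fun _ h => sylvester_eq_zero h₁ h₂ h

theorem exists_lyapunov {F : Matrix (Fin m) (Fin m) ℝ} (hF : IsHurwitz F)
    (Q : Matrix (Fin m) (Fin m) ℝ) : ∃ X, Fᵀ * X + X * F + Q = 0 := by
  obtain ⟨X, hX⟩ := (LinearMap.injective_iff_surjective.1 (sylvesterMap_injective hF hF)) (-Q)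
  exact ⟨X, by rw [show Fᵀ * X + X * F = -Q from hX, neg_add_cancel]⟩

/-- Real form of the eigenvector argument: along an eigenvector with nonnegative real part the
right-hand side of a Lyapunov equation with positive semidefinite solution is nonpositive. -/
theorem lyapunov_eigenvector {F X Q : Matrix (Fin m) (Fin m) ℝ} (hX : Xᵀ = X)
    (h : Fᵀ * X + X * F + Q = 0) {α β : ℝ} {a b : Fin m → ℝ}
    (ha : F *ᵥ a = α • a - β • b) (hb : F *ᵥ b = β • a + α • b) :
    2 * α * (a ⬝ᵥ X *ᵥ a + b ⬝ᵥ X *ᵥ b) + (a ⬝ᵥ Q *ᵥ a + b ⬝ᵥ Q *ᵥ b) = 0 := by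
  have key : ∀ y, (F *ᵥ y) ⬝ᵥ X *ᵥ y + y ⬝ᵥ X *ᵥ (F *ᵥ y) + y ⬝ᵥ Q *ᵥ y = 0 := by
    intro y
    have := congrArg (fun N => y ⬝ᵥ N *ᵥ y) h
    simp only [Matrix.add_mulVec, dotProduct_add, ← Matrix.mulVec_mulVec, Matrix.zero_mulVec,
      dotProduct_zero] at this
    rwa [dotProduct_mulVec_transpose, Matrix.transpose_transpose] at this
  have h1 := key a
  have h2 := key b
  rw [ha] at h1
  rw [hb] at h2
  have h3 := dotProduct_mulVec_comm_of_symm hX a b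
  simp only [Matrix.mulVec_add, Matrix.mulVec_sub, Matrix.mulVec_smul, dotProduct_add,
    dotProduct_sub, dotProduct_smul, add_dotProduct, sub_dotProduct, smul_dotProduct,
    smul_eq_mul] at h1 h2
  linear_combination h1 + h2

/-- Detectability test: if a positive semidefinite `X` solves a Lyapunov equation whose right-hand
side detects every unstable mode, the coefficient is Hurwitz. -/
theorem isHurwitz_of_lyapunov {F X Q : Matrix (Fin m) (Fin m) ℝ} (hX : X.PosSemidef)
    (hQ : ∀ x, 0 ≤ x ⬝ᵥ Q *ᵥ x) (h : Fᵀ * X + X * F + Q = 0)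
    (hd : ∀ (α β : ℝ) (a b : Fin m → ℝ), 0 ≤ α → F *ᵥ a = α • a - β • b →
      F *ᵥ b = β • a + α • b → a ⬝ᵥ Q *ᵥ a = 0 → b ⬝ᵥ Q *ᵥ b = 0 → a = 0 ∧ b = 0) :
    IsHurwitz F := by
  obtain ⟨hs, hn⟩ := posSemidef_real_iff.1 hX
  refine isHurwitz_iff.2 fun α β a b hα ha hb => ?_
  have h1 := lyapunov_eigenvector hs h ha hb
  have h2 : 0 ≤ 2 * α * (a ⬝ᵥ X *ᵥ a + b ⬝ᵥ X *ᵥ b) :=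
    mul_nonneg (by linarith) (add_nonneg (hn a) (hn b))
  exact hd α β a b hα ha hb (by linarith [hQ a, hQ b]) (by linarith [hQ a, hQ b])

/-- A definite right-hand side leaves no mode undetected. -/
theorem isHurwitz_of_isPosForm {F X : Matrix (Fin m) (Fin m) ℝ} (hX : X.PosSemidef)
    (hQ : IsPosForm (-(Fᵀ * X + X * F))) : IsHurwitz F := by
  refine isHurwitz_of_lyapunov hX (Q := -(Fᵀ * X + X * F)) (fun x => ?_) (add_neg_cancel _)
    fun α β a b _ _ _ h1 h2 => ⟨by_contra fun h => (hQ a h).ne' h1,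
      by_contra fun h => (hQ b h).ne' h2⟩
  rcases eq_or_ne x 0 with rfl | hx
  · simp
  · exact (hQ x hx).le

/-- Being Hurwitz is an open condition. -/
theorem IsHurwitz.eventually {F : Matrix (Fin m) (Fin m) ℝ} (hF : IsHurwitz F) :
    ∀ᶠ F' in nhds F, IsHurwitz F' := by
  -- The certificate `X` found at `F` also serves for every nearby matrix.
  obtain ⟨X, hX⟩ := exists_lyapunov hF 1
  have hXp : X.PosSemidef := lyapunov_posSemidef hF Matrix.PosSemidef.one hX
  have hc : ContinuousAt (fun F' : Matrix (Fin m) (Fin m) ℝ => -(F'ᵀ * X + X * F')) F := by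
    fun_prop
  have h1 : IsPosForm (-(Fᵀ * X + X * F)) := by
    rw [eq_neg_of_add_eq_zero_left hX, neg_neg]
    exact isPosForm_one
  filter_upwards [hc.eventually (isOpen_isPosForm.mem_nhds h1)] with F' hF'
  exact isHurwitz_of_isPosForm hXp hF'

end Hurwitz

/-! ### Duality for linear matrix inequalities. -/

section Separation

variable {ι : Type*} [Fintype ι] [DecidableEq ι]

/-- Every linear functional on matrices is `N ↦ tr (Z N)`. -/
theorem exists_trace_representation (φ : Matrix ι ι ℝ →ₗ[ℝ] ℝ) :
    ∃ Z : Matrix ι ι ℝ, ∀ N, φ N = (Z * N).trace := by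
  refine ⟨Matrix.of fun i j => φ (Matrix.single j i 1), fun N => ?_⟩
  conv_lhs => rw [Matrix.matrix_eq_sum_single N]
  simp only [map_sum, Matrix.trace, Matrix.diag, Matrix.mul_apply, Matrix.of_apply]
  rw [Finset.sum_comm]
  refine Finset.sum_congr rfl fun i _ => Finset.sum_congr rfl fun j _ => ?_
  have : Matrix.single j i (N j i) = N j i • Matrix.single j i (1 : ℝ) := by
    rw [Matrix.smul_single, smul_eq_mul, mul_one]
  rw [this, map_smul, smul_eq_mul, mul_comm]

/-- Theorem of the alternative for a linear matrix inequality. -/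
theorem exists_dual_of_not_isPosForm (𝒲 : Submodule ℝ (Matrix ι ι ℝ)) (Θ : Matrix ι ι ℝ)
    (h : ∀ N ∈ 𝒲, ¬ IsPosForm (-(N + Θ))) :
    ∃ Z : Matrix ι ι ℝ, Z.PosSemidef ∧ Z ≠ 0 ∧ (∀ N ∈ 𝒲, (Z * N).trace = 0) ∧
      0 ≤ (Z * Θ).trace := by
  obtain ⟨f, u, hs, ht⟩ := geometric_hahn_banach_open (s := {N : Matrix ι ι ℝ | IsPosForm N})
    (t := {N | ∃ N' ∈ 𝒲, N = -(N' + Θ)}) convex_isPosForm isOpen_isPosForm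
    (by
      rintro _ ⟨N, hN, rfl⟩ _ ⟨N', hN', rfl⟩ a b _ _ hab
      refine ⟨a • N + b • N', 𝒲.add_mem (𝒲.smul_mem _ hN) (𝒲.smul_mem _ hN'), ?_⟩
      have : Θ = a • Θ + b • Θ := by rw [← add_smul, hab, one_smul]
      conv_rhs => rw [this]
      simp only [smul_neg, smul_add]
      abel)
    (by
      rw [Set.disjoint_left]
      rintro _ h1 ⟨N, hN, rfl⟩
      exact h N hN h1)
  have hsmul : ∀ N : Matrix ι ι ℝ, IsPosForm N → ∀ t : ℝ, 0 < t → IsPosForm (t • N) := by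
    intro N hN t ht x hx
    rw [Matrix.smul_mulVec, dotProduct_smul, smul_eq_mul]
    exact mul_pos ht (hN x hx)
  -- A functional bounded above on a cone is nonpositive there.
  have hneg : ∀ N : Matrix ι ι ℝ, IsPosForm N → f N ≤ 0 := by
    intro N hN
    by_contra hf
    rw [not_le] at hf
    have := hs _ (hsmul N hN ((|u| + 1) / f N) (by positivity))
    rw [map_smul, smul_eq_mul, div_mul_cancel₀ _ hf.ne'] at this
    linarith [le_abs_self u]
  have hu : 0 ≤ u := by
    by_contra hu
    rw [not_le] at hu
    have h1 : f 1 < 0 := (hs _ isPosForm_one).trans hu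
    have := hs _ (hsmul 1 isPosForm_one (u / (2 * f 1)) (div_pos_of_neg_of_neg hu (by linarith)))
    rw [map_smul, smul_eq_mul] at this
    have h2 : u / (2 * f 1) * f 1 = u / 2 := by
      have := h1.ne
      field_simp
    linarith
  have hnonneg : ∀ N : Matrix ι ι ℝ, (∀ x, 0 ≤ x ⬝ᵥ N *ᵥ x) → f N ≤ 0 := by
    intro N hN
    refine le_of_forall_pos_le_add fun ε hε => ?_
    have h1 := hneg 1 isPosForm_one
    rcases h1.lt_or_eq with h1 | h1
    · have := hneg (N + (ε / (-f 1)) • (1 : Matrix ι ι ℝ)) fun x hx => by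
        have := hsmul 1 isPosForm_one _ (div_pos hε (neg_pos.2 h1)) x hx
        rw [Matrix.add_mulVec, dotProduct_add]
        linarith [hN x]
      rw [map_add, map_smul, smul_eq_mul] at this
      have h2 : ε / (-f 1) * f 1 = -ε := by
        have := h1.ne
        field_simp
      linarith
    · have := hneg (N + 1) fun x hx => by
        have := isPosForm_one x hx
        rw [Matrix.add_mulVec, dotProduct_add]
        linarith [hN x]
      rw [map_add] at this
      linarith
  -- Skew matrices have zero quadratic form, so `f` kills them. This is where the symmetry of `Z`
  -- comes from, and why the cone is not restricted to symmetric matrices.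
  have hskew : ∀ N : Matrix ι ι ℝ, f Nᵀ = f N := by
    intro N
    have h0 : ∀ x, x ⬝ᵥ Nᵀ *ᵥ x = x ⬝ᵥ N *ᵥ x := fun x => by
      rw [dotProduct_mulVec_transpose, Matrix.transpose_transpose, dotProduct_comm]
    have h1 := hnonneg (Nᵀ - N) fun x => by
      rw [Matrix.sub_mulVec, dotProduct_sub, h0, sub_self]
    have h2 := hnonneg (N - Nᵀ) fun x => by
      rw [Matrix.sub_mulVec, dotProduct_sub, h0, sub_self]
    rw [map_sub] at h1 h2
    linarith
  have hW0 : ∀ N ∈ 𝒲, u ≤ -f N - f Θ := fun N hN => by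
    have := ht _ ⟨N, hN, rfl⟩
    rw [map_neg, map_add] at this
    linarith
  -- A linear functional bounded on one side on a subspace vanishes there.
  have hW : ∀ N ∈ 𝒲, f N = 0 := by
    intro N hN
    by_contra hf
    have := hW0 _ (𝒲.smul_mem ((-f Θ + 1) / f N) hN)
    rw [map_smul, smul_eq_mul, div_mul_cancel₀ _ hf] at this
    linarith
  obtain ⟨Z, hZ⟩ := exists_trace_representation (-f.toLinearMap)
  have hZ' : ∀ N, f N = -(Z * N).trace := fun N => by
    rw [← hZ]
    simp
  refine ⟨Z, posSemidef_real_iff.2 ⟨?_, fun x => ?_⟩, ?_, fun N hN => ?_, ?_⟩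
  · ext i j
    have := hskew (Matrix.single i j 1)
    rw [hZ', hZ', Matrix.transpose_single, neg_inj, Matrix.trace_mul_single,
      Matrix.trace_mul_single] at this
    simpa using this.symm
  · have := hnonneg (Matrix.vecMulVec x x) fun y => by
      rw [Matrix.vecMulVec_mulVec]
      simp only [dotProduct_smul, MulOpposite.smul_eq_mul_unop, MulOpposite.unop_op]
      rw [dotProduct_comm]
      exact mul_self_nonneg _
    rw [hZ', Matrix.mul_vecMulVec, Matrix.trace_vecMulVec] at this
    rw [dotProduct_comm]
    linarith
  · rintro rfl
    have h1 := hs 1 isPosForm_one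
    have h2 := hW0 0 𝒲.zero_mem
    simp only [hZ', zero_mul, Matrix.trace_zero] at h1 h2
    linarith
  · have := hW N hN
    rw [hZ'] at this
    linarith
  · have := hW0 0 𝒲.zero_mem
    rw [map_zero, hZ'] at this
    linarith

end Separation

/-! ### Square roots, pseudoinverses and skew eigensystems. -/

section Decompositions

theorem mulVec_form {ι κ : Type*} [Fintype ι] [Fintype κ] (B : Matrix ι κ ℝ) (Q : Matrix ι ι ℝ)
    (x : κ → ℝ) : (B *ᵥ x) ⬝ᵥ Q *ᵥ (B *ᵥ x) = x ⬝ᵥ (Bᵀ * Q * B) *ᵥ x := by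
  rw [Matrix.mul_assoc, ← Matrix.mulVec_mulVec, dotProduct_mulVec_transpose Bᵀ,
    Matrix.transpose_transpose, Matrix.mulVec_mulVec]

theorem mulVec_dotProduct_self {ι κ : Type*} [Fintype ι] [Fintype κ] (B : Matrix ι κ ℝ)
    (x : κ → ℝ) : (B *ᵥ x) ⬝ᵥ (B *ᵥ x) = x ⬝ᵥ (Bᵀ * B) *ᵥ x := by
  rw [← Matrix.mulVec_mulVec, dotProduct_mulVec_transpose Bᵀ, Matrix.transpose_transpose]

variable {ι : Type*} [Fintype ι] [DecidableEq ι]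

theorem exists_orthogonal_diagonalization {Z : Matrix ι ι ℝ} (hZ : Z.PosSemidef) :
    ∃ (U : Matrix ι ι ℝ) (d : ι → ℝ), Uᵀ * U = 1 ∧ U * Uᵀ = 1 ∧ (∀ i, 0 ≤ d i) ∧
      Z = U * Matrix.diagonal d * Uᵀ := by
  refine ⟨hZ.1.eigenvectorUnitary, hZ.1.eigenvalues, ?_, ?_, hZ.eigenvalues_nonneg, ?_⟩
  · have := Unitary.coe_star_mul_self hZ.1.eigenvectorUnitary
    rwa [Matrix.star_eq_conjTranspose, Matrix.conjTranspose_eq_transpose_of_trivial] at this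
  · have := Unitary.coe_mul_star_self hZ.1.eigenvectorUnitary
    rwa [Unitary.coe_star, Matrix.star_eq_conjTranspose,
      Matrix.conjTranspose_eq_transpose_of_trivial] at this
  · have := hZ.1.spectral_theorem
    rw [Unitary.conjStarAlgAut_apply, Matrix.star_eq_conjTranspose,
      Matrix.conjTranspose_eq_transpose_of_trivial] at this
    exact this

/-- A positive semidefinite matrix has a symmetric square root `V` with a symmetric commuting
pseudoinverse `J`. -/
theorem exists_sqrt_pseudoinverse {Z : Matrix ι ι ℝ} (hZ : Z.PosSemidef) :
    ∃ V J : Matrix ι ι ℝ, Vᵀ = V ∧ Jᵀ = J ∧ V * V = Z ∧ J * V = V * J ∧ V * (V * J) = V := by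
  obtain ⟨U, d, hU1, -, hd, rfl⟩ := exists_orthogonal_diagonalization hZ
  have hmul : ∀ x y : ι → ℝ, (U * Matrix.diagonal x * Uᵀ) * (U * Matrix.diagonal y * Uᵀ) =
      U * Matrix.diagonal (fun i => x i * y i) * Uᵀ := by
    intro x y
    rw [← Matrix.diagonal_mul_diagonal]
    simp only [Matrix.mul_assoc]
    rw [← Matrix.mul_assoc Uᵀ U, hU1, Matrix.one_mul]
  have hsymm : ∀ x : ι → ℝ, (U * Matrix.diagonal x * Uᵀ)ᵀ = U * Matrix.diagonal x * Uᵀ := by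
    intro x
    simp [Matrix.mul_assoc]
  -- The convention `0⁻¹ = 0` makes the second matrix the pseudoinverse, zero on the kernel.
  refine ⟨U * Matrix.diagonal (fun i => √(d i)) * Uᵀ,
    U * Matrix.diagonal (fun i => (√(d i))⁻¹) * Uᵀ, hsymm _, hsymm _, ?_, ?_, ?_⟩
  · simp only [hmul, Real.mul_self_sqrt (hd _)]
  · simp only [hmul, mul_comm]
  · simp only [hmul]
    congr 3
    ext i
    rcases eq_or_ne (√(d i)) 0 with h | h
    · simp [h]
    · field_simp

/-- A real skew-symmetric matrix has a complete system of complex eigenvectors, here written with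
their real parts `a j` and imaginary parts `b j`. -/
theorem exists_skew_eigensystem {T : Matrix ι ι ℝ} (hT : Tᵀ = -T) :
    ∃ (a b : ι → ι → ℝ) (ω : ι → ℝ), (∀ j, T *ᵥ a j = -(ω j • b j)) ∧
      (∀ j, T *ᵥ b j = ω j • a j) ∧
      ∀ i k, ∑ j, (a j i * a j k + b j i * b j k) = (1 : Matrix ι ι ℝ) i k := by
  -- `-iT` is Hermitian, so it has a unitary eigenbasis with real eigenvalues `ω`.
  set H : Matrix ι ι ℂ := (-Complex.I) • T.map ((↑) : ℝ → ℂ) with hH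
  have hH1 : H.IsHermitian := by
    ext i k
    have := congrFun (congrFun hT i) k
    simp only [Matrix.transpose_apply, Matrix.neg_apply] at this
    simp [hH, Matrix.conjTranspose_apply, this]
  set q : ι → ι → ℂ := fun j => (hH1.eigenvectorBasis j).ofLp with hq
  have hTq : ∀ j i, (T.map ((↑) : ℝ → ℂ) *ᵥ q j) i =
      Complex.I * (hH1.eigenvalues j : ℂ) * q j i := by
    intro j i
    have h1 := congrFun (hH1.mulVec_eigenvectorBasis j) i
    have h2 : (H *ᵥ q j) i = -Complex.I * (T.map ((↑) : ℝ → ℂ) *ᵥ q j) i := by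
      rw [hH, Matrix.smul_mulVec, Pi.smul_apply, smul_eq_mul]
    rw [h2, Pi.smul_apply, Complex.real_smul] at h1
    change _ = _ * q j i at h1
    linear_combination Complex.I * h1 + (T.map ((↑) : ℝ → ℂ) *ᵥ q j) i * Complex.I_mul_I
  refine ⟨fun j i => (q j i).re, fun j i => (q j i).im, hH1.eigenvalues, fun j => ?_,
    fun j => ?_, fun i k => ?_⟩
  · ext i
    have := congrArg Complex.re (hTq j i)
    rw [map_ofReal_mulVec] at this
    simpa using this
  · ext i
    have := congrArg Complex.im (hTq j i)
    rw [map_ofReal_mulVec] at this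
    simpa using this
  · have h1 := congrFun (congrFun (Unitary.coe_mul_star_self hH1.eigenvectorUnitary) i) k
    rw [Matrix.mul_apply] at h1
    have h2 := congrArg Complex.re h1
    simp only [Matrix.IsHermitian.eigenvectorUnitary_apply, Complex.re_sum,
      Matrix.one_apply, Complex.mul_re] at h2
    rw [Matrix.one_apply]
    refine Eq.trans (Finset.sum_congr rfl fun j _ => ?_) (h2.trans ?_)
    · simp [hq]
    · split_ifs <;> simp

/-- The hypothesis is the resolution of the identity `∑ (a aᵀ + b bᵀ) = 1`. -/
theorem sum_form_eq_trace {a b : ι → ι → ℝ}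
    (h : ∀ i k, ∑ j, (a j i * a j k + b j i * b j k) = (1 : Matrix ι ι ℝ) i k)
    (N : Matrix ι ι ℝ) : ∑ j, (a j ⬝ᵥ N *ᵥ a j + b j ⬝ᵥ N *ᵥ b j) = N.trace := by
  have : ∀ j, a j ⬝ᵥ N *ᵥ a j + b j ⬝ᵥ N *ᵥ b j =
      ∑ i, ∑ k, N i k * (a j i * a j k + b j i * b j k) := by
    intro j
    simp only [dotProduct, Matrix.mulVec, Finset.mul_sum, ← Finset.sum_add_distrib]
    exact Finset.sum_congr rfl fun i _ => Finset.sum_congr rfl fun k _ => by ring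
  simp only [this]
  rw [Finset.sum_comm]
  simp only [Matrix.trace, Matrix.diag]
  refine Finset.sum_congr rfl fun i _ => ?_
  rw [Finset.sum_comm]
  simp only [← Finset.mul_sum, h, Matrix.one_apply]
  simp

end Decompositions

/-! ### The Kalman–Yakubovich–Popov lemma. -/

section KYP

variable {m n : ℕ}

/-- The strict frequency domain inequality `G(iω)* M G(iω) < g`, `G(s) = (s - A)⁻¹ D`, in terms of
the real and imaginary parts of the state and the disturbance. -/
def FrequencyBound (A : Matrix (Fin m) (Fin m) ℝ) (D : Matrix (Fin m) (Fin n) ℝ)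
    (M : Matrix (Fin m) (Fin m) ℝ) (g : ℝ) : Prop :=
  ∀ (ω : ℝ) (a b : Fin m → ℝ) (c e : Fin n → ℝ), A *ᵥ a + D *ᵥ c = -(ω • b) →
    A *ᵥ b + D *ᵥ e = ω • a → (c ≠ 0 ∨ e ≠ 0) →
    a ⬝ᵥ M *ᵥ a + b ⬝ᵥ M *ᵥ b < g * (c ⬝ᵥ c + e ⬝ᵥ e)

/-- Factor `Z₁ = V²`, `Y = W V`. The constraint `hL` becomes `A V + D W = V T` with `T` skew, so
each eigenvector of `T` gives a steady-state response at a real frequency. Summing the strict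
frequency inequalities over an eigenbasis contradicts `hΘ` unless every response is zero. -/
theorem dual_eq_zero_of_frequencyBound {A M : Matrix (Fin m) (Fin m) ℝ}
    {D : Matrix (Fin m) (Fin n) ℝ} {g : ℝ} (hA : IsHurwitz A) (hg : 0 < g)
    (hf : FrequencyBound A D M g) {Z₁ : Matrix (Fin m) (Fin m) ℝ} {Y : Matrix (Fin n) (Fin m) ℝ}
    {Z₂ : Matrix (Fin n) (Fin n) ℝ} (hZ : (Matrix.fromBlocks Z₁ Yᵀ Y Z₂).PosSemidef)
    (hL : A * Z₁ + D * Y + (A * Z₁ + D * Y)ᵀ = 0)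
    (hΘ : 0 ≤ (Z₁ * M).trace - g * Z₂.trace) : Z₁ = 0 ∧ Z₂ = 0 := by
  have hZ₁ : Z₁.PosSemidef := hZ.submatrix Sum.inl
  have hZ₂ : Z₂.PosSemidef := hZ.submatrix Sum.inr
  obtain ⟨V, J, hVs, hJs, hVV, hcomm, hVVJ⟩ := exists_sqrt_pseudoinverse hZ₁
  have hVJs : (V * J)ᵀ = V * J := by rw [Matrix.transpose_mul, hVs, hJs, hcomm]
  set W : Matrix (Fin n) (Fin m) ℝ := Y * J with hW
  have hZVJ : Z₁ * (V * J) = Z₁ := by rw [← hVV, Matrix.mul_assoc, hVVJ]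
  have hYVJ : Y * (V * J) = Y := by
    -- `V J` projects onto the range of `Z₁`; semidefiniteness of the block matrix puts the kernel
    -- of `Z₁` inside that of `Y`.
    have key : ∀ v, Y *ᵥ (v - (V * J) *ᵥ v) = 0 := by
      intro v
      set w := v - (V * J) *ᵥ v with hw
      have hZw : Z₁ *ᵥ w = 0 := by
        rw [hw, Matrix.mulVec_sub, Matrix.mulVec_mulVec, hZVJ, sub_self]
      have h0 := mulVec_eq_zero_of_form_eq_zero hZ (x := Sum.elim w 0) (by
        rw [Matrix.fromBlocks_mulVec, sumElim_dotProduct_sumElim]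
        simp [hZw])
      rw [Matrix.fromBlocks_mulVec] at h0
      ext i
      simpa using congrFun h0 (Sum.inr i)
    ext i j
    have h1 := congrFun (key (Pi.single j 1)) i
    rw [Matrix.mulVec_sub, Matrix.mulVec_mulVec] at h1
    simp only [Matrix.mulVec_single_one, Pi.sub_apply, Matrix.col_apply, Pi.zero_apply] at h1
    linarith
  have hVJY : V * J * Yᵀ = Yᵀ := by
    have := congrArg Matrix.transpose hYVJ
    rwa [Matrix.transpose_mul, hVJs] at this
  set N := A * Z₁ + D * Y with hN
  have hNt : Nᵀ = -N := (neg_eq_of_add_eq_zero_right hL).symm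
  have hNVJ : N * (V * J) = N := by
    rw [hN, add_mul, Matrix.mul_assoc, hZVJ, Matrix.mul_assoc, hYVJ]
  have hVJN : V * J * N = N := by
    have := congrArg Matrix.transpose hNVJ
    rw [Matrix.transpose_mul, hVJs, hNt, mul_neg, neg_inj] at this
    exact this
  have hVT : V * (J * N * J) = A * V + D * W := by
    rw [← Matrix.mul_assoc, ← Matrix.mul_assoc, hVJN, hN, add_mul, Matrix.mul_assoc, ← hVV,
      Matrix.mul_assoc V, hVVJ, Matrix.mul_assoc D]
  have hTs : (J * N * J)ᵀ = -(J * N * J) := by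
    rw [Matrix.transpose_mul, Matrix.transpose_mul, hJs, hNt]
    simp [Matrix.mul_assoc]
  have hWtr : (Wᵀ * W).trace ≤ Z₂.trace := by
    have hps : (Z₂ - W * Wᵀ).PosSemidef := by
      refine posSemidef_real_iff.2 ⟨?_, fun y => ?_⟩
      · rw [Matrix.transpose_sub, (posSemidef_real_iff.1 hZ₂).1, Matrix.transpose_mul,
          Matrix.transpose_transpose]
      -- This `x` minimizes the block form for fixed `y`; the minimum is the form of the Schur
      -- complement `Z₂ - W Wᵀ`.
      · set x := -((J * J * Yᵀ) *ᵥ y) with hx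
        have h1 := (posSemidef_real_iff.1 hZ).2 (Sum.elim x y)
        rw [Matrix.fromBlocks_mulVec, sumElim_dotProduct_sumElim] at h1
        simp only [Sum.elim_comp_inl, Sum.elim_comp_inr] at h1
        have hZx : Z₁ *ᵥ x + Yᵀ *ᵥ y = 0 := by
          rw [hx, Matrix.mulVec_neg, Matrix.mulVec_mulVec, neg_add_eq_zero, ← hVV]
          have : V * V * (J * J * Yᵀ) = V * (V * J) * J * Yᵀ := by simp only [Matrix.mul_assoc]
          rw [this, hVVJ, hVJY]
        have hYx : Y *ᵥ x = -((W * Wᵀ) *ᵥ y) := by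
          rw [hx, Matrix.mulVec_neg, Matrix.mulVec_mulVec, hW, Matrix.transpose_mul, hJs]
          simp only [Matrix.mul_assoc]
        rw [hZx, hYx, dotProduct_zero, zero_add, neg_add_eq_sub, ← Matrix.sub_mulVec] at h1
        exact h1
    have := hps.trace_nonneg
    rw [Matrix.trace_sub, Matrix.trace_mul_comm] at this
    linarith
  obtain ⟨a, b, ω, ha, hb, hab⟩ := exists_skew_eigensystem hTs
  have hfa : ∀ j, A *ᵥ (V *ᵥ a j) + D *ᵥ (W *ᵥ a j) = -(ω j • (V *ᵥ b j)) := by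
    intro j
    rw [Matrix.mulVec_mulVec, Matrix.mulVec_mulVec, ← Matrix.add_mulVec, ← hVT,
      ← Matrix.mulVec_mulVec, ha, Matrix.mulVec_neg, Matrix.mulVec_smul]
  have hfb : ∀ j, A *ᵥ (V *ᵥ b j) + D *ᵥ (W *ᵥ b j) = ω j • (V *ᵥ a j) := by
    intro j
    rw [Matrix.mulVec_mulVec, Matrix.mulVec_mulVec, ← Matrix.add_mulVec, ← hVT,
      ← Matrix.mulVec_mulVec, hb, Matrix.mulVec_smul]
  set t : Fin m → ℝ := fun j => (V *ᵥ a j) ⬝ᵥ M *ᵥ (V *ᵥ a j) + (V *ᵥ b j) ⬝ᵥ M *ᵥ (V *ᵥ b j) -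
    g * ((W *ᵥ a j) ⬝ᵥ (W *ᵥ a j) + (W *ᵥ b j) ⬝ᵥ (W *ᵥ b j)) with ht
  -- An undriven steady oscillation would be an imaginary eigenvalue of `A`.
  have hzero : ∀ j, W *ᵥ a j = 0 → W *ᵥ b j = 0 → V *ᵥ a j = 0 ∧ V *ᵥ b j = 0 := by
    intro j h1 h2
    have h3 := hfa j
    have h4 := hfb j
    rw [h1, Matrix.mulVec_zero, add_zero] at h3
    rw [h2, Matrix.mulVec_zero, add_zero] at h4
    exact isHurwitz_iff.1 hA 0 (ω j) _ _ le_rfl (by rw [h3, zero_smul, zero_sub])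
      (by rw [h4, zero_smul, add_zero])
  have htneg : ∀ j, t j ≤ 0 ∧ (t j = 0 → W *ᵥ a j = 0 ∧ W *ᵥ b j = 0) := by
    intro j
    by_cases h : W *ᵥ a j ≠ 0 ∨ W *ᵥ b j ≠ 0
    · have := hf _ _ _ _ _ (hfa j) (hfb j) h
      have h2 : t j < 0 := by simp only [ht]; linarith
      exact ⟨h2.le, fun h3 => absurd h3 h2.ne⟩
    · push Not at h
      obtain ⟨h1, h2⟩ := h
      obtain ⟨h3, h4⟩ := hzero j h1 h2
      refine ⟨?_, fun _ => ⟨h1, h2⟩⟩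
      simp [ht, h1, h2, h3, h4]
  have htsum : ∑ j, t j = (Z₁ * M).trace - g * (Wᵀ * W).trace := by
    have h1 := sum_form_eq_trace hab (Vᵀ * M * V)
    have h2 := sum_form_eq_trace hab (Wᵀ * W)
    simp only [← mulVec_form] at h1
    simp only [← mulVec_dotProduct_self] at h2
    rw [ht, Finset.sum_sub_distrib, ← Finset.mul_sum, h1, h2, hVs, Matrix.trace_mul_comm,
      ← Matrix.mul_assoc, hVV]
  -- The terms are nonpositive, while `hΘ` and `tr(Wᵀ W) ≤ tr Z₂` make the sum nonnegative.
  have hsum0 : ∑ j, t j = 0 := by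
    refine le_antisymm (Finset.sum_nonpos fun j _ => (htneg j).1) ?_
    rw [htsum]
    nlinarith
  have hall := (Finset.sum_eq_zero_iff_of_nonpos fun j _ => (htneg j).1).1 hsum0
  have hW0 : ∀ j, W *ᵥ a j = 0 ∧ W *ᵥ b j = 0 := fun j => (htneg j).2 (hall j (Finset.mem_univ j))
  have hV0 : ∀ j, V *ᵥ a j = 0 ∧ V *ᵥ b j = 0 := fun j => hzero j (hW0 j).1 (hW0 j).2
  have hZ₁0 : Z₁ = 0 := by
    have h1 := sum_form_eq_trace hab (Vᵀ * V)
    simp only [← mulVec_dotProduct_self, (hV0 _).1, (hV0 _).2, dotProduct_zero, add_zero,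
      Finset.sum_const_zero] at h1
    rw [hVs, hVV] at h1
    exact hZ₁.trace_eq_zero_iff.1 h1.symm
  refine ⟨hZ₁0, hZ₂.trace_eq_zero_iff.1 (le_antisymm ?_ hZ₂.trace_nonneg)⟩
  rw [hZ₁0, Matrix.zero_mul, Matrix.trace_zero] at hΘ
  nlinarith

/-- The symmetric matrix of the Kalman–Yakubovich–Popov inequality. -/
def kypMatrix (A : Matrix (Fin m) (Fin m) ℝ) (D : Matrix (Fin m) (Fin n) ℝ)
    (M : Matrix (Fin m) (Fin m) ℝ) (g : ℝ) (P : Matrix (Fin m) (Fin m) ℝ) :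
    Matrix (Fin m ⊕ Fin n) (Fin m ⊕ Fin n) ℝ :=
  Matrix.fromBlocks (Aᵀ * P + P * A + M) (P * D) (Dᵀ * P) (-(g • 1))

/-- Dissipation reading: the rate of the storage `xᵀ P x` along `ẋ = A x + D w`, plus `xᵀ M x - g
|w|²`. -/
theorem kypMatrix_form {A M P : Matrix (Fin m) (Fin m) ℝ} (D : Matrix (Fin m) (Fin n) ℝ) (g : ℝ)
    (hP : Pᵀ = P) (x : Fin m → ℝ) (w : Fin n → ℝ) :
    Sum.elim x w ⬝ᵥ kypMatrix A D M g P *ᵥ Sum.elim x w =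
      2 * (x ⬝ᵥ P *ᵥ (A *ᵥ x + D *ᵥ w)) + x ⬝ᵥ M *ᵥ x - g * (w ⬝ᵥ w) := by
  have h1 : x ⬝ᵥ (Aᵀ * P) *ᵥ x = x ⬝ᵥ P *ᵥ (A *ᵥ x) := by
    rw [← Matrix.mulVec_mulVec, dotProduct_mulVec_transpose, Matrix.transpose_transpose,
      dotProduct_mulVec_comm_of_symm hP]
  have h2 : w ⬝ᵥ (Dᵀ * P) *ᵥ x = x ⬝ᵥ P *ᵥ (D *ᵥ w) := by
    rw [← Matrix.mulVec_mulVec, dotProduct_mulVec_transpose, Matrix.transpose_transpose,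
      dotProduct_mulVec_comm_of_symm hP]
  rw [← Matrix.mulVec_mulVec] at h1 h2
  rw [kypMatrix, Matrix.fromBlocks_mulVec, sumElim_dotProduct_sumElim]
  simp only [Sum.elim_comp_inl, Sum.elim_comp_inr, dotProduct_add, Matrix.add_mulVec,
    Matrix.neg_mulVec, dotProduct_neg, Matrix.smul_mulVec, Matrix.one_mulVec, dotProduct_smul,
    smul_eq_mul, Matrix.mulVec_add, ← Matrix.mulVec_mulVec]
  linear_combination h1 + h2

/-- The Kalman–Yakubovich–Popov lemma: a strict frequency domain inequality is certified by a
strict linear matrix inequality. -/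
theorem exists_kyp {A M : Matrix (Fin m) (Fin m) ℝ} {D : Matrix (Fin m) (Fin n) ℝ} {g : ℝ}
    (hA : IsHurwitz A) (hg : 0 < g) (hf : FrequencyBound A D M g) :
    ∃ P, Pᵀ = P ∧ IsPosForm (-(kypMatrix A D M g P)) := by
  by_contra hcon
  push Not at hcon
  let 𝒲 : Submodule ℝ (Matrix (Fin m ⊕ Fin n) (Fin m ⊕ Fin n) ℝ) :=
    { carrier := {N | ∃ P : Matrix (Fin m) (Fin m) ℝ, Pᵀ = P ∧
        N = Matrix.fromBlocks (Aᵀ * P + P * A) (P * D) (Dᵀ * P) 0}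
      zero_mem' := ⟨0, by simp, by simp⟩
      add_mem' := by
        rintro _ _ ⟨P, hP, rfl⟩ ⟨P', hP', rfl⟩
        refine ⟨P + P', by rw [Matrix.transpose_add, hP, hP'], ?_⟩
        rw [Matrix.fromBlocks_add]
        simp only [mul_add, add_mul, Matrix.mul_add, Matrix.add_mul, add_zero]
        congr 1
        abel
      smul_mem' := by
        rintro c _ ⟨P, hP, rfl⟩
        refine ⟨c • P, by rw [Matrix.transpose_smul, hP], ?_⟩
        rw [Matrix.fromBlocks_smul]
        simp }
  obtain ⟨Z, hZ, hZ0, hZW, hZΘ⟩ := exists_dual_of_not_isPosForm 𝒲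
    (Matrix.fromBlocks M 0 0 (-(g • (1 : Matrix (Fin n) (Fin n) ℝ)))) (by
      rintro _ ⟨P, hP, rfl⟩
      rw [Matrix.fromBlocks_add, add_zero, add_zero, zero_add]
      exact hcon P hP)
  obtain ⟨Z₁, Y', Y, Z₂, rfl⟩ : ∃ Z₁ Y' Y Z₂, Z = Matrix.fromBlocks Z₁ Y' Y Z₂ :=
    ⟨_, _, _, _, (Matrix.fromBlocks_toBlocks Z).symm⟩
  obtain rfl : Y' = Yᵀ := by
    have := (posSemidef_real_iff.1 hZ).1
    rw [Matrix.fromBlocks_transpose, Matrix.fromBlocks_inj] at this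
    exact this.2.1.symm
  have hZ₁s : Z₁ᵀ = Z₁ := (posSemidef_real_iff.1 (hZ.submatrix Sum.inl)).1
  have htr : ∀ (N₁ : Matrix (Fin m) (Fin m) ℝ) (N₂ : Matrix (Fin n) (Fin n) ℝ) N₃ N₄,
      (Matrix.fromBlocks N₁ N₃ N₄ N₂).trace = N₁.trace + N₂.trace := by
    intro N₁ N₂ N₃ N₄
    simp [Matrix.trace]
  have hL : A * Z₁ + D * Y + (A * Z₁ + D * Y)ᵀ = 0 := by
    set N := A * Z₁ + D * Y + (A * Z₁ + D * Y)ᵀ with hN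
    have hNs : Nᵀ = N := by
      rw [hN, Matrix.transpose_add, Matrix.transpose_transpose, add_comm]
    -- Testing orthogonality against `P = N` itself gives `tr(N²) = 0`.
    have h1 := hZW _ ⟨N, hNs, rfl⟩
    rw [Matrix.fromBlocks_multiply, htr, Matrix.mul_zero, add_zero] at h1
    have h2 : (N * N).trace = 0 := by
      rw [← h1]
      nth_rw 1 [hN]
      simp only [Matrix.mul_add, Matrix.add_mul, Matrix.transpose_add, Matrix.transpose_mul,
        Matrix.trace_add, hZ₁s]
      rw [Matrix.trace_mul_comm Z₁ (N * A), Matrix.trace_mul_comm Y (N * D),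
        Matrix.mul_assoc N A, Matrix.mul_assoc N D, Matrix.trace_mul_comm N, Matrix.trace_mul_comm N,
        Matrix.mul_assoc Z₁, Matrix.mul_assoc Yᵀ]
      ring
    have h3 := Matrix.trace_conjTranspose_mul_self_eq_zero_iff (A := N)
    rw [Matrix.conjTranspose_eq_transpose_of_trivial, hNs] at h3
    exact h3.1 h2
  have hΘ : 0 ≤ (Z₁ * M).trace - g * Z₂.trace := by
    rw [Matrix.fromBlocks_multiply, htr] at hZΘ
    simpa [sub_eq_add_neg] using hZΘ
  obtain ⟨h1, h2⟩ := dual_eq_zero_of_frequencyBound hA hg hf hZ hL hΘ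
  refine hZ0 (hZ.trace_eq_zero_iff.1 ?_)
  rw [htr, h1, h2]
  simp

/-- In a steady oscillation the storage rates of the real and imaginary parts cancel. The
definiteness margin `ε` gives `g' = g - ε`, uniformly in the frequency. -/
theorem frequency_le_of_kyp {A M P : Matrix (Fin m) (Fin m) ℝ} {D : Matrix (Fin m) (Fin n) ℝ}
    {g : ℝ} (hP : Pᵀ = P) (h : IsPosForm (-(kypMatrix A D M g P))) :
    ∃ g', g' < g ∧ ∀ (ω : ℝ) (a b : Fin m → ℝ) (c e : Fin n → ℝ), A *ᵥ a + D *ᵥ c = -(ω • b) →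
      A *ᵥ b + D *ᵥ e = ω • a → a ⬝ᵥ M *ᵥ a + b ⬝ᵥ M *ᵥ b ≤ g' * (c ⬝ᵥ c + e ⬝ᵥ e) := by
  obtain ⟨ε, hε, hb⟩ := h.exists_lower_bound
  refine ⟨g - ε, by linarith, fun ω a b c e ha hb' => ?_⟩
  have h1 := hb (Sum.elim a c)
  have h2 := hb (Sum.elim b e)
  rw [Matrix.neg_mulVec, dotProduct_neg, kypMatrix_form D g hP,
    sumElim_dotProduct_sumElim] at h1 h2
  rw [ha] at h1
  rw [hb'] at h2
  have h3 := dotProduct_mulVec_comm_of_symm hP a b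
  simp only [Matrix.mulVec_neg, dotProduct_neg, Matrix.mulVec_smul, dotProduct_smul,
    smul_eq_mul] at h1 h2
  have h4 : 0 ≤ a ⬝ᵥ a := Finset.sum_nonneg fun i _ => mul_self_nonneg _
  have h5 : 0 ≤ b ⬝ᵥ b := Finset.sum_nonneg fun i _ => mul_self_nonneg _
  rw [h3] at h1
  nlinarith [mul_nonneg hε.le h4, mul_nonneg hε.le h5]

/-- Schur complement of the Kalman–Yakubovich–Popov inequality: a strict Riccati inequality. -/
theorem riccati_lt_of_kyp {A M P : Matrix (Fin m) (Fin m) ℝ} {D : Matrix (Fin m) (Fin n) ℝ}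
    {γ : ℝ} (hγ : 0 < γ) (hP : Pᵀ = P) (h : IsPosForm (-(kypMatrix A D M (γ ^ 2) P))) :
    IsPosForm (-(Aᵀ * P + P * A + M + P * ((γ⁻¹ ^ 2) • (D * Dᵀ)) * P)) := by
  intro x hx
  -- The worst-case disturbance, which maximizes the form over `w`.
  set w := (γ⁻¹ ^ 2) • (Dᵀ *ᵥ (P *ᵥ x)) with hw
  have h1 := h (Sum.elim x w) fun h0 => hx (by
    ext i
    simpa using congrFun h0 (Sum.inl i))
  rw [Matrix.neg_mulVec, dotProduct_neg, kypMatrix_form D _ hP] at h1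
  have h2 : x ⬝ᵥ (Aᵀ * P) *ᵥ x = x ⬝ᵥ P *ᵥ (A *ᵥ x) := by
    rw [← Matrix.mulVec_mulVec, dotProduct_mulVec_transpose, Matrix.transpose_transpose,
      dotProduct_mulVec_comm_of_symm hP]
  have h3 : ∀ v, x ⬝ᵥ P *ᵥ (D *ᵥ v) = (Dᵀ *ᵥ (P *ᵥ x)) ⬝ᵥ v := by
    intro v
    rw [dotProduct_mulVec_transpose, hP, dotProduct_mulVec_transpose]
  rw [Matrix.mulVec_add, dotProduct_add, h3, hw] at h1
  rw [Matrix.neg_mulVec, dotProduct_neg]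
  simp only [Matrix.add_mulVec, dotProduct_add, ← Matrix.mulVec_mulVec, Matrix.smul_mulVec,
    Matrix.mulVec_smul, dotProduct_smul, smul_dotProduct, smul_eq_mul, h3] at h1 h2 ⊢
  rw [h2]
  have h4 : γ ^ 2 * (γ⁻¹ ^ 2 * (γ⁻¹ ^ 2 * (Dᵀ *ᵥ P *ᵥ x ⬝ᵥ Dᵀ *ᵥ P *ᵥ x))) =
      γ⁻¹ ^ 2 * (Dᵀ *ᵥ P *ᵥ x ⬝ᵥ Dᵀ *ᵥ P *ᵥ x) := by
    field_simp
  linarith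

end KYP

/-! ### Riccati equations: comparison and Newton's iteration. -/

section Riccati

/-- A monotone sequence of symmetric matrices with bounded quadratic forms converges. -/
theorem exists_tendsto_of_monotone_form {ι : Type*} [Fintype ι] {P : ℕ → Matrix ι ι ℝ}
    (hs : ∀ k, (P k)ᵀ = P k) (hm : ∀ k x, x ⬝ᵥ P k *ᵥ x ≤ x ⬝ᵥ P (k + 1) *ᵥ x)
    {B : Matrix ι ι ℝ} (hB : ∀ k x, x ⬝ᵥ P k *ᵥ x ≤ x ⬝ᵥ B *ᵥ x) :
    ∃ L, Filter.Tendsto P Filter.atTop (nhds L) := by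
  classical
  have hq : ∀ x, ∃ c, Filter.Tendsto (fun k => x ⬝ᵥ P k *ᵥ x) Filter.atTop (nhds c) := fun x =>
    ⟨_, tendsto_atTop_ciSup (monotone_nat_of_le_succ fun k => hm k x)
      ⟨x ⬝ᵥ B *ᵥ x, by rintro _ ⟨k, rfl⟩; exact hB k x⟩⟩
  choose c hc using hq
  -- Polarization recovers the entries from the quadratic form.
  have hpol : ∀ k i j, P k i j = ((Pi.single i 1 + Pi.single j 1 : ι → ℝ) ⬝ᵥ
      P k *ᵥ (Pi.single i 1 + Pi.single j 1) - (Pi.single i 1 : ι → ℝ) ⬝ᵥ P k *ᵥ Pi.single i 1 -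
      (Pi.single j 1 : ι → ℝ) ⬝ᵥ P k *ᵥ Pi.single j 1) / 2 := by
    intro k i j
    have := congrFun (congrFun (hs k) i) j
    rw [Matrix.transpose_apply] at this
    simp [Matrix.mulVec_add, add_dotProduct, this]
    ring
  refine ⟨fun i j => (c (Pi.single i 1 + Pi.single j 1) - c (Pi.single i 1) -
    c (Pi.single j 1)) / 2, tendsto_pi_nhds.2 fun i => tendsto_pi_nhds.2 fun j => ?_⟩
  exact ((((hc _).sub (hc _)).sub (hc _)).div_const 2).congr fun k => (hpol k i j).symm

variable {m : ℕ}

/-- The left-hand side of the Riccati equation `Aᵀ P + P A + M + P S P = 0`. -/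
def riccatiResidual (A S M P : Matrix (Fin m) (Fin m) ℝ) : Matrix (Fin m) (Fin m) ℝ :=
  Aᵀ * P + P * A + M + P * S * P

/-- The exact second-order Taylor expansion at `N`; its linear part is the Lyapunov operator of `A +
S N`. -/
theorem riccatiResidual_sub {A S M P N : Matrix (Fin m) (Fin m) ℝ} (hS : Sᵀ = S) (hN : Nᵀ = N) :
    (A + S * N)ᵀ * (P - N) + (P - N) * (A + S * N) + (P - N) * S * (P - N) =
      riccatiResidual A S M P - riccatiResidual A S M N := by
  rw [Matrix.transpose_add, Matrix.transpose_mul, hS, hN, riccatiResidual, riccatiResidual]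
  noncomm_ring

theorem form_mul_mul_nonneg {S X : Matrix (Fin m) (Fin m) ℝ} (hS : S.PosSemidef) (hX : Xᵀ = X)
    (x : Fin m → ℝ) : 0 ≤ x ⬝ᵥ (X * S * X) *ᵥ x := by
  have := mulVec_form X S x
  rw [hX] at this
  rw [← this]
  exact (posSemidef_real_iff.1 hS).2 _

/-- Comparison: a stabilizing solution of the Riccati equation lies below every symmetric solution
of the Riccati inequality. -/
theorem riccati_comparison {A S M P N Q : Matrix (Fin m) (Fin m) ℝ} (hS : S.PosSemidef)
    (hP : Pᵀ = P) (hN : Nᵀ = N) (hNr : riccatiResidual A S M N = 0) (hF : IsHurwitz (A + S * N))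
    (hQ : ∀ x, 0 ≤ x ⬝ᵥ Q *ᵥ x) (hPr : riccatiResidual A S M P + Q = 0) (x : Fin m → ℝ) :
    0 ≤ x ⬝ᵥ (P - N) *ᵥ x := by
  refine hF.lyapunov_nonneg (Q := (P - N) * S * (P - N) + Q) (fun y => ?_) ?_ x
  · rw [Matrix.add_mulVec, dotProduct_add]
    exact add_nonneg (form_mul_mul_nonneg hS (by rw [Matrix.transpose_sub, hP, hN]) y) (hQ y)
  · rw [← add_assoc, riccatiResidual_sub (posSemidef_real_iff.1 hS).1 hN (M := M), hNr, sub_zero,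
      hPr]

/-- The gap `X = B - N` is a Lyapunov certificate: its Lyapunov expression is the residual at `B`
minus that at `N` minus `X S X`, which is negative definite. -/
theorem isHurwitz_of_riccati_lt {A S M B N : Matrix (Fin m) (Fin m) ℝ} (hS : S.PosSemidef)
    (hN : Nᵀ = N) (hNr : ∀ x, 0 ≤ x ⬝ᵥ riccatiResidual A S M N *ᵥ x)
    (hB : IsPosForm (-riccatiResidual A S M B)) (hX : (B - N).PosSemidef) :
    IsHurwitz (A + S * N) := by
  obtain ⟨hXs, -⟩ := posSemidef_real_iff.1 hX
  refine isHurwitz_of_isPosForm hX fun x hx => ?_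
  have h1 := riccatiResidual_sub (A := A) (M := M) (P := B) (posSemidef_real_iff.1 hS).1 hN
  rw [eq_sub_of_add_eq h1]
  have h2 := hB x hx
  have h3 := form_mul_mul_nonneg hS hXs x
  have h4 := hNr x
  simp only [Matrix.neg_mulVec, Matrix.sub_mulVec, dotProduct_neg, dotProduct_sub] at h2 ⊢
  linarith

/-- One step of the Newton iteration for the Riccati equation. -/
theorem riccati_newton_step {A S M B P : Matrix (Fin m) (Fin m) ℝ} (hS : S.PosSemidef)
    (hMs : Mᵀ = M) (hBs : Bᵀ = B) (hB : IsPosForm (-riccatiResidual A S M B)) (hP : Pᵀ = P)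
    (hPr : ∀ x, 0 ≤ x ⬝ᵥ riccatiResidual A S M P *ᵥ x) (hF : IsHurwitz (A + S * P)) :
    ∃ N, (A + S * P)ᵀ * N + N * (A + S * P) + (M - P * S * P) = 0 ∧ Nᵀ = N ∧
      (∀ x, x ⬝ᵥ P *ᵥ x ≤ x ⬝ᵥ N *ᵥ x) ∧ (∀ x, 0 ≤ x ⬝ᵥ riccatiResidual A S M N *ᵥ x) ∧
      (B - N).PosSemidef ∧ IsHurwitz (A + S * N) := by
  obtain ⟨hSs, -⟩ := posSemidef_real_iff.1 hS
  obtain ⟨N, hN⟩ := exists_lyapunov hF (M - P * S * P)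
  have hNs : Nᵀ = N := lyapunov_transpose_eq hF
    (by simp only [Matrix.transpose_sub, Matrix.transpose_mul, hMs, hP, hSs, Matrix.mul_assoc]) hN
  have hF' : (A + S * P)ᵀ = Aᵀ + P * S := by
    rw [Matrix.transpose_add, Matrix.transpose_mul, hSs, hP]
  -- A Newton step cancels the linear part, so only the quadratic error remains.
  have hres : riccatiResidual A S M N = (N - P) * S * (N - P) := by
    rw [hF'] at hN
    rw [← sub_eq_zero, ← hN, riccatiResidual]
    noncomm_ring
  have hNr : ∀ x, 0 ≤ x ⬝ᵥ riccatiResidual A S M N *ᵥ x := fun x => by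
    rw [hres]
    exact form_mul_mul_nonneg hS (by rw [Matrix.transpose_sub, hNs, hP]) x
  have hX : (B - N).PosSemidef := by
    refine posSemidef_real_iff.2 ⟨by rw [Matrix.transpose_sub, hNs, hBs], ?_⟩
    refine hF.lyapunov_nonneg (Q := (B - P) * S * (B - P) - riccatiResidual A S M B)
      (fun x => ?_) ?_
    · rw [Matrix.sub_mulVec, dotProduct_sub]
      have h1 := form_mul_mul_nonneg hS (X := B - P) (by rw [Matrix.transpose_sub, hP, hBs]) x
      rcases eq_or_ne x 0 with rfl | hx
      · simp
      · have h2 := hB x hx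
        rw [Matrix.neg_mulVec, dotProduct_neg] at h2
        linarith
    · rw [hF'] at hN ⊢
      rw [← neg_zero, ← hN, riccatiResidual]
      noncomm_ring
  refine ⟨N, hN, hNs, fun x => ?_, hNr, hX, isHurwitz_of_riccati_lt hS hNs hNr hB hX⟩
  have := hF.lyapunov_nonneg (X := N - P) hPr (by
    rw [hF'] at hN ⊢
    rw [← hN, riccatiResidual]
    noncomm_ring) x
  rw [Matrix.sub_mulVec, dotProduct_sub] at this
  linarith

/-- A strict Riccati inequality yields a stabilizing solution of the Riccati equation. -/
theorem exists_stabilizing_of_riccati_lt {A S M B : Matrix (Fin m) (Fin m) ℝ} (hA : IsHurwitz A)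
    (hS : S.PosSemidef) (hM : M.PosSemidef) (hBs : Bᵀ = B)
    (hB : IsPosForm (-riccatiResidual A S M B)) :
    ∃ P, P.PosSemidef ∧ riccatiResidual A S M P = 0 ∧ IsHurwitz (A + S * P) := by
  obtain ⟨hMs, hM0⟩ := posSemidef_real_iff.1 hM
  let Inv : Matrix (Fin m) (Fin m) ℝ → Prop := fun P => Pᵀ = P ∧
    (∀ x, 0 ≤ x ⬝ᵥ riccatiResidual A S M P *ᵥ x) ∧ IsHurwitz (A + S * P)
  have hstep : ∀ P : {P // Inv P}, ∃ N : {P // Inv P},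
      (A + S * P.1)ᵀ * N.1 + N.1 * (A + S * P.1) + (M - P.1 * S * P.1) = 0 ∧
      (∀ x, x ⬝ᵥ P.1 *ᵥ x ≤ x ⬝ᵥ N.1 *ᵥ x) ∧ (B - N.1).PosSemidef := by
    rintro ⟨P, hP, hPr, hF⟩
    obtain ⟨N, h1, h2, h3, h4, h5, h6⟩ := riccati_newton_step hS hMs hBs hB hP hPr hF
    exact ⟨⟨N, h2, h4, h6⟩, h1, h3, h5⟩
  choose next hnext hle hup using hstep
  -- At `P = 0` the residual is `M ≥ 0` and the loop is `A` itself.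
  let P : ℕ → {P // Inv P} := fun k => next^[k] ⟨0, by simp, by simpa [riccatiResidual] using hM0,
    by simpa using hA⟩
  have hP0 : (P 0).1 = 0 := rfl
  have hPs : ∀ k, P (k + 1) = next (P k) := fun k => Function.iterate_succ_apply' _ _ _
  have hmono : ∀ k x, x ⬝ᵥ (P k).1 *ᵥ x ≤ x ⬝ᵥ (P (k + 1)).1 *ᵥ x := fun k x => by
    rw [hPs]
    exact hle _ x
  have hPB : ∀ k x, x ⬝ᵥ (P (k + 1)).1 *ᵥ x ≤ x ⬝ᵥ B *ᵥ x := fun k x => by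
    have := (posSemidef_real_iff.1 (hup (P k))).2 x
    rw [← hPs, Matrix.sub_mulVec, dotProduct_sub] at this
    linarith
  obtain ⟨L, hL⟩ := exists_tendsto_of_monotone_form (fun k => (P k).2.1) hmono
    (fun k x => (hmono k x).trans (hPB k x))
  have hL1 := hL.comp (Filter.tendsto_add_atTop_nat 1)
  have hLs : Lᵀ = L := by
    have hc : Continuous fun N : Matrix (Fin m) (Fin m) ℝ => Nᵀ := by fun_prop
    exact tendsto_nhds_unique ((hc.tendsto L).comp hL) (hL.congr fun k => (P k).2.1.symm)
  have hform : ∀ x, Filter.Tendsto (fun k => x ⬝ᵥ (P k).1 *ᵥ x) Filter.atTop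
      (nhds (x ⬝ᵥ L *ᵥ x)) := fun x => by
    have hc : Continuous fun N : Matrix (Fin m) (Fin m) ℝ => x ⬝ᵥ N *ᵥ x := by fun_prop
    exact (hc.tendsto L).comp hL
  have hL0 : ∀ x, 0 ≤ x ⬝ᵥ L *ᵥ x := fun x => by
    have := (monotone_nat_of_le_succ fun k => hmono k x).ge_of_tendsto (hform x) 0
    simpa [hP0] using this
  have hLB : (B - L).PosSemidef := by
    refine posSemidef_real_iff.2 ⟨by rw [Matrix.transpose_sub, hBs, hLs], fun x => ?_⟩
    rw [Matrix.sub_mulVec, dotProduct_sub, sub_nonneg]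
    exact le_of_tendsto' (hform x) fun k => (hmono k x).trans (hPB k x)
  have hLr : riccatiResidual A S M L = 0 := by
    have hc : Continuous fun p : Matrix (Fin m) (Fin m) ℝ × Matrix (Fin m) (Fin m) ℝ =>
        (A + S * p.1)ᵀ * p.2 + p.2 * (A + S * p.1) + (M - p.1 * S * p.1) := by fun_prop
    have h1 := (hc.tendsto (L, L)).comp (hL.prodMk_nhds hL1)
    have h2 := tendsto_nhds_unique h1 ((tendsto_const_nhds (x := (0 : Matrix (Fin m) (Fin m) ℝ))).congr
      fun k => by
      rw [← hnext (P k), ← hPs]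
      rfl)
    rw [← h2, Matrix.transpose_add, Matrix.transpose_mul, (posSemidef_real_iff.1 hS).1, hLs,
      riccatiResidual]
    noncomm_ring
  -- Stability of the iterates alone does not pass to the limit; the strict inequality at `B`
  -- supplies it.
  exact ⟨L, posSemidef_real_iff.2 ⟨hLs, hL0⟩, hLr, isHurwitz_of_riccati_lt hS hLs
    (fun x => by rw [hLr]; simp) hB hLB⟩

end Riccati

/-! ### Transfer functions on the imaginary axis. -/

section Frequency

variable {m n p : ℕ}

open scoped Matrix.Norms.L2Operator in
theorem norm_mulVec_le {ι κ : Type*} [Fintype ι] [Fintype κ] [DecidableEq κ] (G : Matrix ι κ ℂ)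
    (w : κ → ℂ) : ‖WithLp.toLp 2 (G *ᵥ w)‖ ≤ ‖G‖ * ‖WithLp.toLp 2 w‖ :=
  Matrix.l2_opNorm_mulVec G (WithLp.toLp 2 w)

open scoped Matrix.Norms.L2Operator in
theorem norm_le_of_forall_mulVec {ι κ : Type*} [Fintype ι] [Fintype κ] [DecidableEq κ]
    (G : Matrix ι κ ℂ) {c : ℝ} (hc : 0 ≤ c)
    (h : ∀ w, ‖WithLp.toLp 2 (G *ᵥ w)‖ ≤ c * ‖WithLp.toLp 2 w‖) : ‖G‖ ≤ c := by
  rw [Matrix.l2_opNorm_def]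
  exact ContinuousLinearMap.opNorm_le_bound _ hc fun x => h x.ofLp

theorem norm_sq_toLp {ι : Type*} [Fintype ι] (v : ι → ℂ) :
    ‖WithLp.toLp 2 v‖ ^ 2 = (fun i => (v i).re) ⬝ᵥ (fun i => (v i).re) +
      (fun i => (v i).im) ⬝ᵥ (fun i => (v i).im) := by
  rw [EuclideanSpace.norm_sq_eq, dotProduct, dotProduct, ← Finset.sum_add_distrib]
  refine Finset.sum_congr rfl fun i _ => ?_
  rw [← Complex.normSq_eq_norm_sq, Complex.normSq_apply]

theorem IsHurwitz.isUnit_imaginary {A : Matrix (Fin m) (Fin m) ℝ} (hA : IsHurwitz A) (ω : ℝ) :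
    IsUnit ((Complex.I * (ω : ℂ)) • (1 : Matrix (Fin m) (Fin m) ℂ) -
      A.map ((↑) : ℝ → ℂ)).det := by
  rw [← Matrix.isUnit_iff_isUnit_det, ← Algebra.algebraMap_eq_smul_one]
  by_contra h
  have := hA _ (spectrum.mem_iff.2 h)
  simp at this

/-- The response of a transfer function on the imaginary axis in terms of real and imaginary
parts of the state. -/
theorem norm_sq_transferFunction_mulVec {A : Matrix (Fin m) (Fin m) ℝ} (hA : IsHurwitz A)
    (D : Matrix (Fin m) (Fin n) ℝ) (C : Matrix (Fin p) (Fin m) ℝ) {ω : ℝ} {a b : Fin m → ℝ}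
    (w : Fin n → ℂ) (ha : A *ᵥ a + D *ᵥ (fun i => (w i).re) = -(ω • b))
    (hb : A *ᵥ b + D *ᵥ (fun i => (w i).im) = ω • a) :
    ‖WithLp.toLp 2 (transferFunction A D C (Complex.I * (ω : ℂ)) *ᵥ w)‖ ^ 2 =
      a ⬝ᵥ (Cᵀ * C) *ᵥ a + b ⬝ᵥ (Cᵀ * C) *ᵥ b := by
  set v : Fin m → ℂ := fun i => ⟨a i, b i⟩ with hv
  set N := (Complex.I * (ω : ℂ)) • (1 : Matrix (Fin m) (Fin m) ℂ) - A.map ((↑) : ℝ → ℂ) with hN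
  have h1 : N *ᵥ v = D.map ((↑) : ℝ → ℂ) *ᵥ w := by
    rw [hN, Matrix.sub_mulVec, Matrix.smul_mulVec, Matrix.one_mulVec]
    ext i
    have h2 := congrFun ha i
    have h3 := congrFun hb i
    rw [Pi.sub_apply, map_ofReal_mulVec, map_ofReal_mulVec]
    simp only [Pi.add_apply, Pi.neg_apply, Pi.smul_apply, smul_eq_mul] at h2 h3
    apply Complex.ext
    · simp [hv]
      linarith
    · simp [hv]
      linarith
  have h2 : transferFunction A D C (Complex.I * (ω : ℂ)) *ᵥ w = C.map ((↑) : ℝ → ℂ) *ᵥ v := by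
    rw [transferFunction, ← Matrix.mulVec_mulVec, ← h1, ← hN, Matrix.mulVec_mulVec,
      Matrix.mul_assoc, Matrix.nonsing_inv_mul _ (hA.isUnit_imaginary ω), Matrix.mul_one]
  rw [h2, norm_sq_toLp]
  simp only [map_ofReal_mulVec]
  rw [← mulVec_dotProduct_self, ← mulVec_dotProduct_self]

theorem IsHurwitz.exists_response {A : Matrix (Fin m) (Fin m) ℝ} (hA : IsHurwitz A)
    (D : Matrix (Fin m) (Fin n) ℝ) (ω : ℝ) (c e : Fin n → ℝ) :
    ∃ a b : Fin m → ℝ, A *ᵥ a + D *ᵥ c = -(ω • b) ∧ A *ᵥ b + D *ᵥ e = ω • a := by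
  set N := (Complex.I * (ω : ℂ)) • (1 : Matrix (Fin m) (Fin m) ℂ) - A.map ((↑) : ℝ → ℂ) with hN
  set w : Fin n → ℂ := fun i => ⟨c i, e i⟩ with hw
  set v := N⁻¹ *ᵥ (D.map ((↑) : ℝ → ℂ) *ᵥ w) with hv
  have h1 : N *ᵥ v = D.map ((↑) : ℝ → ℂ) *ᵥ w := by
    rw [hv, Matrix.mulVec_mulVec, Matrix.mul_nonsing_inv _ (hA.isUnit_imaginary ω),
      Matrix.one_mulVec]
  rw [hN, Matrix.sub_mulVec, Matrix.smul_mulVec, Matrix.one_mulVec] at h1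
  refine ⟨fun i => (v i).re, fun i => (v i).im, ?_, ?_⟩
  · ext i
    have := congrArg Complex.re (congrFun h1 i)
    rw [Pi.sub_apply, map_ofReal_mulVec, map_ofReal_mulVec] at this
    simp [hw] at this
    simp only [Pi.add_apply, Pi.neg_apply, Pi.smul_apply, smul_eq_mul]
    linarith
  · ext i
    have := congrArg Complex.im (congrFun h1 i)
    rw [Pi.sub_apply, map_ofReal_mulVec, map_ofReal_mulVec] at this
    simp [hw] at this
    simp only [Pi.add_apply, Pi.smul_apply, smul_eq_mul]
    linarith

theorem frequencyBound_of_hInfNorm_lt {A : Matrix (Fin m) (Fin m) ℝ} (hA : IsHurwitz A)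
    {D : Matrix (Fin m) (Fin n) ℝ} {C : Matrix (Fin p) (Fin m) ℝ} {γ : ℝ} (hγ : 0 < γ)
    (h : hInfNorm (transferFunction A D C) < ENNReal.ofReal γ) :
    FrequencyBound A D (Cᵀ * C) (γ ^ 2) := by
  open scoped Matrix.Norms.L2Operator in
  intro ω a b c e ha hb hce
  set w : Fin n → ℂ := fun i => ⟨c i, e i⟩ with hw
  have h1 : ‖transferFunction A D C (Complex.I * (ω : ℂ))‖ < γ := by
    have := lt_of_le_of_lt (le_iSup (fun ω : ℝ => ENNReal.ofReal
      ‖transferFunction A D C (Complex.I * (ω : ℂ))‖) ω) h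
    exact (ENNReal.ofReal_lt_ofReal_iff hγ).1 this
  have hw0 : WithLp.toLp 2 w ≠ 0 := by
    intro h0
    have hwi : ∀ i, w i = 0 := fun i => congrFun (congrArg WithLp.ofLp h0) i
    rcases hce with hc | he
    · exact hc (funext fun i => congrArg Complex.re (hwi i))
    · exact he (funext fun i => congrArg Complex.im (hwi i))
  have h2 := norm_mulVec_le (transferFunction A D C (Complex.I * (ω : ℂ))) w
  have h3 : ‖WithLp.toLp 2 (transferFunction A D C (Complex.I * (ω : ℂ)) *ᵥ w)‖ <
      γ * ‖WithLp.toLp 2 w‖ := h2.trans_lt (mul_lt_mul_of_pos_right h1 (norm_pos_iff.2 hw0))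
  have h4 := pow_lt_pow_left₀ h3 (norm_nonneg _) two_ne_zero
  rwa [norm_sq_transferFunction_mulVec hA D C w ha hb, mul_pow, norm_sq_toLp] at h4

/-- The gap `g < γ ^ 2` keeps the supremum over frequencies strictly below `γ`. -/
theorem hInfNorm_lt_of_frequency_le {A : Matrix (Fin m) (Fin m) ℝ} (hA : IsHurwitz A)
    {D : Matrix (Fin m) (Fin n) ℝ} {C : Matrix (Fin p) (Fin m) ℝ} {γ : ℝ} (hγ : 0 < γ) {g : ℝ}
    (hg : g < γ ^ 2) (h : ∀ (ω : ℝ) (a b : Fin m → ℝ) (c e : Fin n → ℝ),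
      A *ᵥ a + D *ᵥ c = -(ω • b) → A *ᵥ b + D *ᵥ e = ω • a →
      a ⬝ᵥ (Cᵀ * C) *ᵥ a + b ⬝ᵥ (Cᵀ * C) *ᵥ b ≤ g * (c ⬝ᵥ c + e ⬝ᵥ e)) :
    hInfNorm (transferFunction A D C) < ENNReal.ofReal γ := by
  open scoped Matrix.Norms.L2Operator in
  -- Negative `g` is allowed: then `√g = 0`, and in general `(√g)² = max g 0 ≥ g`.
  have h1 : √g < γ := (Real.sqrt_lt' hγ).2 hg
  refine lt_of_le_of_lt (iSup_le fun ω => ENNReal.ofReal_le_ofReal ?_)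
    ((ENNReal.ofReal_lt_ofReal_iff hγ).2 h1)
  refine norm_le_of_forall_mulVec _ (Real.sqrt_nonneg g) fun w => ?_
  obtain ⟨a, b, ha, hb⟩ := hA.exists_response D ω (fun i => (w i).re) (fun i => (w i).im)
  have h2 := h ω a b _ _ ha hb
  rw [← norm_sq_transferFunction_mulVec hA D C w ha hb, ← norm_sq_toLp] at h2
  refine le_of_sq_le_sq ?_ (by positivity)
  rw [mul_pow]
  exact h2.trans (mul_le_mul_of_nonneg_right
    ((le_max_left g 0).trans (Real.sq_sqrt' ▸ le_rfl)) (sq_nonneg _))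

end Frequency

/-! ### The strict bounded real lemma for the closed loop. -/

namespace Plant

variable {m d n l : ℕ} (S : Plant m d n l)

/-- The closed-loop state weight `Cᵀ C + Kᵀ R K`. -/
def weight (K : Matrix (Fin d) (Fin m) ℝ) : Matrix (Fin m) (Fin m) ℝ :=
  S.Cᵀ * S.C + Kᵀ * S.R * K

/-- The scaled disturbance matrix `γ⁻² D Dᵀ`. -/
def noise (γ : ℝ) : Matrix (Fin m) (Fin m) ℝ := (γ⁻¹ ^ 2) • (S.D * S.Dᵀ)

theorem posSemidef_transpose_mul_self {ι κ : Type*} [Fintype ι] [Fintype κ] (C : Matrix ι κ ℝ) :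
    (Cᵀ * C).PosSemidef := by
  simpa using Matrix.posSemidef_conjTranspose_mul_self C

theorem R_posSemidef : S.R.PosSemidef := posSemidef_transpose_mul_self S.E

theorem R_transpose : S.Rᵀ = S.R := (posSemidef_real_iff.1 S.R_posSemidef).1

theorem weight_posSemidef (K : Matrix (Fin d) (Fin m) ℝ) : (S.weight K).PosSemidef := by
  refine (posSemidef_transpose_mul_self S.C).add ?_
  simpa using S.R_posSemidef.conjTranspose_mul_mul_same K

theorem noise_posSemidef (γ : ℝ) : (S.noise γ).PosSemidef := by
  refine Matrix.PosSemidef.smul ?_ (sq_nonneg _)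
  simpa using posSemidef_transpose_mul_self S.Dᵀ

theorem noise_transpose (γ : ℝ) : (S.noise γ)ᵀ = S.noise γ :=
  (posSemidef_real_iff.1 (S.noise_posSemidef γ)).1

theorem worstCaseLoop_eq (γ : ℝ) (K : Matrix (Fin d) (Fin m) ℝ) (P : Matrix (Fin m) (Fin m) ℝ) :
    S.worstCaseLoop γ K P = S.closedLoop K + S.noise γ * P := by
  rw [worstCaseLoop, noise, smul_mul_assoc]

theorem riccatiResidual_eq (γ : ℝ) (K : Matrix (Fin d) (Fin m) ℝ)
    (P : Matrix (Fin m) (Fin m) ℝ) :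
    riccatiResidual (S.closedLoop K) (S.noise γ) (S.weight K) P =
      (S.closedLoop K)ᵀ * P + P * S.closedLoop K + S.Cᵀ * S.C + Kᵀ * S.R * K +
        (γ⁻¹ ^ 2) • (P * S.D * S.Dᵀ * P) := by
  rw [riccatiResidual, noise, weight, mul_smul_comm, smul_mul_assoc, ← add_assoc,
    Matrix.mul_assoc P S.D]

theorem isStabilizingSolution_iff {γ : ℝ} {K : Matrix (Fin d) (Fin m) ℝ}
    {P : Matrix (Fin m) (Fin m) ℝ} : S.IsStabilizingSolution γ K P ↔ P.PosSemidef ∧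
      riccatiResidual (S.closedLoop K) (S.noise γ) (S.weight K) P = 0 ∧
      IsHurwitz (S.closedLoop K + S.noise γ * P) := by
  rw [riccatiResidual_eq, ← worstCaseLoop_eq]
  exact ⟨fun h => ⟨h.1, h.2, h.3⟩, fun h => ⟨h.1, h.2.1, h.2.2⟩⟩

theorem IsStabilizingSolution.riccatiSolution_eq {S : Plant m d n l} {γ : ℝ}
    {K : Matrix (Fin d) (Fin m) ℝ} {P : Matrix (Fin m) (Fin m) ℝ}
    (h : S.IsStabilizingSolution γ K P) : S.riccatiSolution γ K = P := by
  have hex : ∃ P, S.IsStabilizingSolution γ K P := ⟨P, h⟩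
  rw [riccatiSolution, dif_pos hex]
  exact hex.choose_spec.unique h

theorem outputSqrt_sq (K : Matrix (Fin d) (Fin m) ℝ) :
    (S.outputSqrt K)ᵀ * S.outputSqrt K = S.weight K := by
  open scoped MatrixOrder in
  have h1 : S.outputSqrt K * S.outputSqrt K = S.weight K :=
    CFC.sqrt_mul_sqrt_self _ (S.weight_posSemidef K).nonneg
  have h2 : (S.outputSqrt K).PosSemidef := Matrix.nonneg_iff_posSemidef.1 (CFC.sqrt_nonneg _)
  rw [(posSemidef_real_iff.1 h2).1, h1]

theorem mem_feasible_of_frequency_le {γ : ℝ} (hγ : 0 < γ) {K : Matrix (Fin d) (Fin m) ℝ}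
    (hK : IsHurwitz (S.closedLoop K)) {g : ℝ} (hg : g < γ ^ 2)
    (h : ∀ (ω : ℝ) (a b : Fin m → ℝ) (c e : Fin n → ℝ),
      S.closedLoop K *ᵥ a + S.D *ᵥ c = -(ω • b) → S.closedLoop K *ᵥ b + S.D *ᵥ e = ω • a →
      a ⬝ᵥ S.weight K *ᵥ a + b ⬝ᵥ S.weight K *ᵥ b ≤ g * (c ⬝ᵥ c + e ⬝ᵥ e)) :
    K ∈ S.feasible γ := by
  refine ⟨hK, hInfNorm_lt_of_frequency_le hK hγ hg ?_⟩
  rwa [outputSqrt_sq]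

/-- Strict bounded real lemma for the closed loop. -/
theorem exists_kyp_of_mem_feasible {γ : ℝ} (hγ : 0 < γ) {K : Matrix (Fin d) (Fin m) ℝ}
    (hK : K ∈ S.feasible γ) : ∃ P, Pᵀ = P ∧
      IsPosForm (-(kypMatrix (S.closedLoop K) S.D (S.weight K) (γ ^ 2) P)) := by
  have := frequencyBound_of_hInfNorm_lt hK.1 hγ hK.2
  rw [outputSqrt_sq] at this
  exact exists_kyp hK.1 (by positivity) this

theorem mem_feasible_of_kyp {γ : ℝ} (hγ : 0 < γ) {K : Matrix (Fin d) (Fin m) ℝ}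
    (hK : IsHurwitz (S.closedLoop K)) {P : Matrix (Fin m) (Fin m) ℝ} (hP : Pᵀ = P)
    (h : IsPosForm (-(kypMatrix (S.closedLoop K) S.D (S.weight K) (γ ^ 2) P))) :
    K ∈ S.feasible γ := by
  obtain ⟨g, hg, hb⟩ := frequency_le_of_kyp hP h
  exact S.mem_feasible_of_frequency_le hγ hK hg hb

theorem exists_frequency_le_of_mem_feasible {γ : ℝ} (hγ : 0 < γ) {K : Matrix (Fin d) (Fin m) ℝ}
    (hK : K ∈ S.feasible γ) : ∃ g, g < γ ^ 2 ∧ ∀ (ω : ℝ) (a b : Fin m → ℝ) (c e : Fin n → ℝ),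
      S.closedLoop K *ᵥ a + S.D *ᵥ c = -(ω • b) → S.closedLoop K *ᵥ b + S.D *ᵥ e = ω • a →
      a ⬝ᵥ S.weight K *ᵥ a + b ⬝ᵥ S.weight K *ᵥ b ≤ g * (c ⬝ᵥ c + e ⬝ᵥ e) := by
  obtain ⟨P, hP, h⟩ := S.exists_kyp_of_mem_feasible hγ hK
  exact frequency_le_of_kyp hP h

theorem continuous_closedLoop : Continuous S.closedLoop := by
  unfold closedLoop
  fun_prop

theorem continuous_weight : Continuous S.weight := by
  unfold weight
  fun_prop

/-- A strict certificate `P` for `K` remains one, unchanged, for all nearby gains. -/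
theorem isOpen_feasible {γ : ℝ} (hγ : 0 < γ) : IsOpen (S.feasible γ) := by
  refine isOpen_iff_eventually.2 fun K hK => ?_
  obtain ⟨P, hP, h⟩ := S.exists_kyp_of_mem_feasible hγ hK
  have hc : Continuous fun K =>
      -(kypMatrix (S.closedLoop K) S.D (S.weight K) (γ ^ 2) P) := by
    have h1 := S.continuous_closedLoop
    have h2 := S.continuous_weight
    unfold kypMatrix
    fun_prop
  filter_upwards [S.continuous_closedLoop.continuousAt.eventually hK.1.eventually,
    hc.continuousAt.eventually (isOpen_isPosForm.mem_nhds h)] with K' h1 h2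
  exact S.mem_feasible_of_kyp hγ h1 hP h2

/-- Feasible gains admit a stabilizing solution of the Riccati equation. -/
theorem isStabilizingSolution_riccatiSolution {γ : ℝ} (hγ : 0 < γ)
    {K : Matrix (Fin d) (Fin m) ℝ} (hK : K ∈ S.feasible γ) :
    S.IsStabilizingSolution γ K (S.riccatiSolution γ K) := by
  obtain ⟨B, hB, h⟩ := S.exists_kyp_of_mem_feasible hγ hK
  obtain ⟨P, hP⟩ := exists_stabilizing_of_riccati_lt hK.1 (S.noise_posSemidef γ)
    (S.weight_posSemidef K) hB (riccati_lt_of_kyp hγ hB h)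
  have := S.isStabilizingSolution_iff.2 hP
  rwa [this.riccatiSolution_eq]

end Plant

/-! ### Differentiability of the Riccati solution and of the cost. -/

section Calculus

open scoped Matrix.Norms.Elementwise

theorem contDiff_matrix_mul {E ι κ μ : Type*} [NormedAddCommGroup E] [NormedSpace ℝ E] [Fintype ι]
    [Fintype κ] [Fintype μ] {f : E → Matrix ι κ ℝ} {g : E → Matrix κ μ ℝ}
    (hf : ContDiff ℝ 1 f) (hg : ContDiff ℝ 1 g) : ContDiff ℝ 1 fun x => f x * g x := by
  refine contDiff_pi.2 fun i => contDiff_pi.2 fun j => ?_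
  simp only [Matrix.mul_apply]
  exact ContDiff.sum fun k _ =>
    (contDiff_pi.1 (contDiff_pi.1 hf i) k).mul (contDiff_pi.1 (contDiff_pi.1 hg k) j)

theorem contDiff_matrix_transpose {E ι κ : Type*} [NormedAddCommGroup E] [NormedSpace ℝ E]
    [Fintype ι] [Fintype κ] {f : E → Matrix ι κ ℝ} (hf : ContDiff ℝ 1 f) :
    ContDiff ℝ 1 fun x => (f x)ᵀ :=
  contDiff_pi.2 fun i => contDiff_pi.2 fun j => contDiff_pi.1 (contDiff_pi.1 hf j) i

/-- The residual is quadratic along the lines used, so its derivative is the coefficient of `t`. -/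
theorem fderiv_apply_of_quadratic {E F : Type*} [NormedAddCommGroup E] [NormedSpace ℝ E]
    [NormedAddCommGroup F] [NormedSpace ℝ F] {f : E → F} {f' : E →L[ℝ] F} {u v : E}
    (hf : HasFDerivAt f f' u) {c₀ c₁ c₂ : F}
    (h : ∀ t : ℝ, f (u + t • v) = c₀ + t • c₁ + t ^ 2 • c₂) : f' v = c₁ := by
  have h1 : HasDerivAt (fun t : ℝ => u + t • v) v 0 := by
    simpa using ((hasDerivAt_id (0 : ℝ)).smul_const v).const_add u
  have h2 : HasDerivAt (fun t : ℝ => f (u + t • v)) (f' v) 0 :=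
    HasFDerivAt.comp_hasDerivAt (0 : ℝ) (by simpa using hf) h1
  have h3 : HasDerivAt (fun t : ℝ => c₀ + t • c₁ + t ^ 2 • c₂) c₁ 0 := by
    have h4 := (((hasDerivAt_id (0 : ℝ)).smul_const c₁).const_add c₀).add
      ((hasDerivAt_pow 2 (0 : ℝ)).smul_const c₂)
    simp only [one_smul, Nat.cast_ofNat, Nat.add_one_sub_one, pow_one, mul_zero, zero_smul,
      add_zero] at h4
    exact h4
  simp only [h] at h2
  exact h2.unique h3

/-- The implicit function theorem in finite dimension, with the derivative of the implicit function
characterized by the linearized equation. -/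
theorem exists_implicit_function {E F : Type*} [NormedAddCommGroup E] [NormedSpace ℝ E]
    [FiniteDimensional ℝ E] [NormedAddCommGroup F] [NormedSpace ℝ F] [FiniteDimensional ℝ F]
    {f : E × F → F} {f' : E × F →L[ℝ] F} {u : E} {v : F} (hf : HasStrictFDerivAt f f' (u, v))
    (h0 : f (u, v) = 0) (hinj : ∀ y, f' (0, y) = 0 → y = 0) :
    ∃ (φ : E → F) (φ' : E →L[ℝ] F), HasFDerivAt φ φ' u ∧ φ u = v ∧
      (∀ᶠ x in nhds u, f (x, φ x) = 0) ∧ ∀ H, f' (H, φ' H) = 0 := by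
  have : CompleteSpace E := FiniteDimensional.complete ℝ E
  have : CompleteSpace F := FiniteDimensional.complete ℝ F
  have hinv : (f' ∘L .inr ℝ E F).IsInvertible := by
    have hinj' : Function.Injective (f' ∘L .inr ℝ E F).toLinearMap :=
      (injective_iff_map_eq_zero _).2 fun y hy => hinj y (by simpa using hy)
    refine ⟨(LinearEquiv.ofBijective _
      ⟨hinj', LinearMap.injective_iff_surjective.1 hinj'⟩).toContinuousLinearEquiv, ?_⟩
    ext1 y
    rfl
  have hφ := (hf.hasStrictFDerivAt_implicitFunctionOfProdDomain hinv).hasFDerivAt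
  have hφu : hf.implicitFunctionOfProdDomain hinv u = v :=
    (hf.eventually_apply_eq_iff_implicitFunctionOfProdDomain hinv).self_of_nhds.1 rfl
  have hφe := hf.eventually_apply_implicitFunctionOfProdDomain hinv
  rw [h0] at hφe
  refine ⟨_, _, hφ, hφu, hφe, fun H => ?_⟩
  have h1 := HasFDerivAt.comp (g := f) (g' := f') u (by simpa [hφu] using hf.hasFDerivAt)
    ((hasFDerivAt_id u).prodMk hφ)
  have h2 := h1.unique ((hasFDerivAt_const (0 : F) u).congr_of_eventuallyEq hφe)
  exact DFunLike.congr_fun h2 H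

namespace Plant

variable {m d n l : ℕ} (S : Plant m d n l)

/-- The Riccati residual as a function of the gain and the candidate solution. -/
def residual (γ : ℝ) (p : Matrix (Fin d) (Fin m) ℝ × Matrix (Fin m) (Fin m) ℝ) :
    Matrix (Fin m) (Fin m) ℝ :=
  riccatiResidual (S.closedLoop p.1) (S.noise γ) (S.weight p.1) p.2

theorem contDiff_residual (γ : ℝ) : ContDiff ℝ 1 (S.residual γ) := by
  have h1 : ContDiff ℝ 1 fun p : Matrix (Fin d) (Fin m) ℝ × Matrix (Fin m) (Fin m) ℝ =>
    S.closedLoop p.1 := contDiff_const.sub (contDiff_matrix_mul contDiff_const contDiff_fst)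
  have h2 : ContDiff ℝ 1 fun p : Matrix (Fin d) (Fin m) ℝ × Matrix (Fin m) (Fin m) ℝ =>
    S.weight p.1 := contDiff_const.add (contDiff_matrix_mul (contDiff_matrix_mul
      (contDiff_matrix_transpose contDiff_fst) contDiff_const) contDiff_fst)
  have h3 : ContDiff ℝ 1 fun p : Matrix (Fin d) (Fin m) ℝ × Matrix (Fin m) (Fin m) ℝ => p.2 :=
    contDiff_snd
  exact (((contDiff_matrix_mul (contDiff_matrix_transpose h1) h3).add
    (contDiff_matrix_mul h3 h1)).add h2).add
      (contDiff_matrix_mul (contDiff_matrix_mul h3 contDiff_const) h3)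

/-- Local smooth dependence of the stabilizing solution on the gain, with the Lyapunov equation
for its derivative. -/
theorem exists_local_riccatiSolution {γ : ℝ} {K : Matrix (Fin d) (Fin m) ℝ}
    {P : Matrix (Fin m) (Fin m) ℝ} (hK : IsHurwitz (S.closedLoop K))
    (hP : S.IsStabilizingSolution γ K P) :
    ∃ φ : Matrix (Fin d) (Fin m) ℝ → Matrix (Fin m) (Fin m) ℝ,
      ∃ φ' : Matrix (Fin d) (Fin m) ℝ →L[ℝ] Matrix (Fin m) (Fin m) ℝ,
        HasFDerivAt φ φ' K ∧ (∀ᶠ K' in nhds K, S.IsStabilizingSolution γ K' (φ K')) ∧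
        ∀ H, (S.worstCaseLoop γ K P)ᵀ * φ' H + φ' H * S.worstCaseLoop γ K P +
          (Hᵀ * (S.R * K - S.Bᵀ * P) + (S.R * K - S.Bᵀ * P)ᵀ * H) = 0 := by
  obtain ⟨hP0, hPr, hF⟩ := S.isStabilizingSolution_iff.1 hP
  have hPs := (posSemidef_real_iff.1 hP0).1
  have hTs := S.noise_transpose γ
  set F := S.closedLoop K + S.noise γ * P with hFdef
  have hFt : Fᵀ = (S.closedLoop K)ᵀ + P * S.noise γ := by
    rw [hFdef, Matrix.transpose_add, Matrix.transpose_mul, hPs, hTs]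
  have hf := (S.contDiff_residual γ).contDiffAt.hasStrictFDerivAt (x := (K, P)) one_ne_zero
  set f' := fderiv ℝ (S.residual γ) (K, P)
  -- The partial derivative in the solution is injective because `F` is Hurwitz, as the implicit
  -- function theorem requires.
  have hinr : ∀ Y, f' (0, Y) = sylvesterMap F F Y := fun Y =>
    fderiv_apply_of_quadratic hf.hasFDerivAt (c₀ := S.residual γ (K, P))
      (c₂ := Y * S.noise γ * Y) fun t => by
      change riccatiResidual (S.closedLoop (K + t • 0)) _ (S.weight (K + t • 0)) (P + t • Y) =
        riccatiResidual _ _ _ _ + t • (Fᵀ * Y + Y * F) + _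
      rw [hFt, smul_zero, add_zero, riccatiResidual, riccatiResidual, hFdef]
      simp only [mul_add, add_mul, smul_mul_assoc, mul_smul_comm, smul_add, smul_smul, sq,
        Matrix.mul_assoc]
      abel
  have hinl : ∀ H, f' (H, 0) = Hᵀ * (S.R * K - S.Bᵀ * P) + (S.R * K - S.Bᵀ * P)ᵀ * H :=
    fun H => fderiv_apply_of_quadratic hf.hasFDerivAt (c₀ := S.residual γ (K, P))
      (c₂ := Hᵀ * S.R * H) fun t => by
      change riccatiResidual (S.closedLoop (K + t • H)) _ (S.weight (K + t • H)) (P + t • 0) =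
        riccatiResidual _ _ _ _ + _ + _
      rw [smul_zero, add_zero, riccatiResidual, riccatiResidual, closedLoop, closedLoop, weight,
        weight]
      simp only [Matrix.transpose_add, Matrix.transpose_sub, Matrix.transpose_mul,
        Matrix.transpose_smul, S.R_transpose, hPs, Matrix.transpose_transpose, Matrix.mul_add,
        Matrix.add_mul, Matrix.mul_sub, Matrix.sub_mul, Matrix.smul_mul, Matrix.mul_smul,
        smul_add, smul_sub, smul_smul, sq, Matrix.mul_assoc]
      abel
  obtain ⟨φ, φ', hφ, hφK, hφe, hφ'⟩ := exists_implicit_function hf hPr fun Y hY =>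
    (injective_iff_map_eq_zero _).1 (sylvesterMap_injective hF hF) Y ((hinr Y).symm.trans hY)
  refine ⟨φ, φ', hφ, ?_, fun H => ?_⟩
  · have hc : ContinuousAt φ K := hφ.continuousAt
    have hcl := S.continuous_closedLoop.continuousAt (x := K)
    have hc1 : Filter.Tendsto (fun K' => S.closedLoop K' + S.noise γ * φ K') (nhds K) (nhds F) := by
      have h1 : Continuous fun N : Matrix (Fin m) (Fin m) ℝ => S.noise γ * N := by fun_prop
      have h2 := hcl.tendsto.add (h1.continuousAt.tendsto.comp hc.tendsto)
      rwa [hφK] at h2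
    -- The implicit solution is not known to be symmetric. Its transpose solves the same equation,
    -- and the difference solves a homogeneous Sylvester equation whose coefficient is this loop.
    have hc2 : Filter.Tendsto (fun K' => S.closedLoop K' + S.noise γ * (φ K')ᵀ) (nhds K)
        (nhds F) := by
      have h1 : Continuous fun N : Matrix (Fin m) (Fin m) ℝ => S.noise γ * Nᵀ := by fun_prop
      have h2 := hcl.tendsto.add (h1.continuousAt.tendsto.comp hc.tendsto)
      rwa [hφK, hPs] at h2
    filter_upwards [hφe, hcl.eventually hK.eventually, hc1.eventually hF.eventually,
      hc2.eventually hF.eventually] with K' h1 h2 h3 h4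
    have hW := S.weight_posSemidef K'
    have hs : (φ K')ᵀ = φ K' := by
      refine (sub_eq_zero.1 (sylvester_eq_zero h4 h4 ?_)).symm
      have h5 := congrArg Matrix.transpose h1
      rw [residual, riccatiResidual] at h1 h5
      simp only [Matrix.transpose_add, Matrix.transpose_mul, Matrix.transpose_transpose, hTs,
        (posSemidef_real_iff.1 hW).1, Matrix.transpose_zero] at h5 ⊢
      rw [← sub_eq_zero.2 (h1.trans h5.symm)]
      noncomm_ring
    refine S.isStabilizingSolution_iff.2 ⟨?_, h1, h3⟩
    refine lyapunov_posSemidef h2 (hW.add ?_) (by rw [← add_assoc]; exact h1)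
    refine posSemidef_real_iff.2 ⟨?_, form_mul_mul_nonneg (S.noise_posSemidef γ) hs⟩
    simp only [Matrix.transpose_mul, hs, hTs, Matrix.mul_assoc]
  · rw [worstCaseLoop_eq, ← hinl H]
    change sylvesterMap F F _ + _ = 0
    rw [← hinr, ← map_add, Prod.mk_add_mk, zero_add, add_zero]
    exact hφ' H

/-- Differentiability of the cost and its directional derivatives. -/
theorem differentiableAt_cost {γ : ℝ} (hγ : 0 < γ) {K : Matrix (Fin d) (Fin m) ℝ}
    (hK : K ∈ S.feasible γ) : DifferentiableAt ℝ (S.cost γ) K ∧ ∀ H, ∃ Y : Matrix (Fin m) (Fin m) ℝ,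
      (S.worstCaseLoop γ K (S.riccatiSolution γ K))ᵀ * Y +
        Y * S.worstCaseLoop γ K (S.riccatiSolution γ K) +
        (Hᵀ * (S.R * K - S.Bᵀ * S.riccatiSolution γ K) +
          (S.R * K - S.Bᵀ * S.riccatiSolution γ K)ᵀ * H) = 0 ∧
      fderiv ℝ (S.cost γ) K H = (Y * (S.D * S.Dᵀ)).trace := by
  obtain ⟨φ, φ', hφ, he, hY⟩ := S.exists_local_riccatiSolution hK.1
    (S.isStabilizingSolution_riccatiSolution hγ hK)
  let τ : Matrix (Fin m) (Fin m) ℝ →L[ℝ] ℝ := LinearMap.toContinuousLinearMap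
    ((Matrix.traceLinearMap (Fin m) ℝ ℝ).comp (LinearMap.mulRight ℝ (S.D * S.Dᵀ)))
  have hτ : ∀ Y, τ Y = (Y * (S.D * S.Dᵀ)).trace := fun _ => rfl
  have h1 : HasFDerivAt (S.cost γ) (τ ∘L φ') K := by
    refine (τ.hasFDerivAt.comp K hφ).congr_of_eventuallyEq ?_
    filter_upwards [he] with K' h
    rw [cost, h.riccatiSolution_eq, Function.comp, hτ, Matrix.mul_assoc]
  exact ⟨h1.differentiableAt, fun H => ⟨φ' H, hY H, by rw [h1.fderiv]; rfl⟩⟩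

end Plant

end Calculus

/-- An injective endomorphism in finite dimension reflects membership in an invariant subspace. -/
theorem mem_of_apply_mem_of_invariant {E : Type*} [AddCommGroup E] [Module ℝ E]
    [FiniteDimensional ℝ E] {T : E →ₗ[ℝ] E} (hT : Function.Injective T) {𝒱 : Submodule ℝ E}
    (h𝒱 : ∀ x ∈ 𝒱, T x ∈ 𝒱) {x : E} (hx : T x ∈ 𝒱) : x ∈ 𝒱 := by
  have hinj : Function.Injective (T.restrict h𝒱) := fun y z hyz =>
    Subtype.ext (hT (congrArg Subtype.val hyz))
  obtain ⟨y, hy⟩ := LinearMap.injective_iff_surjective.1 hinj ⟨T x, hx⟩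
  have : T y = T x := congrArg Subtype.val hy
  rw [← hT this]
  exact y.2

/-! ### Controllable subspaces and Gramians. -/

section Controllability

variable {m n p : ℕ}

/-- Full row rank means that the columns of the `F ^ j * D` span the state space. -/
theorem IsControllable.eq_zero {F : Matrix (Fin m) (Fin m) ℝ} {D : Matrix (Fin m) (Fin n) ℝ}
    (h : IsControllable F D) {Z : Matrix (Fin p) (Fin m) ℝ} (hZ : ∀ j, Z * F ^ j * D = 0) :
    Z = 0 := by
  have h1 : Z * controllabilityMatrix F D = 0 := by
    ext i ⟨k, q⟩
    have := congrFun (congrFun (hZ k) i) q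
    rw [Matrix.mul_assoc] at this
    exact this
  have h2 : LinearMap.range (controllabilityMatrix F D).mulVecLin = ⊤ := by
    apply Submodule.eq_top_of_finrank_eq
    rw [Module.finrank_fin_fun]
    exact h
  have h3 : ∀ v, Z *ᵥ v = 0 := by
    intro v
    obtain ⟨y, rfl⟩ : v ∈ LinearMap.range (controllabilityMatrix F D).mulVecLin := h2 ▸ trivial
    rw [Matrix.mulVecLin_apply, Matrix.mulVec_mulVec, h1, Matrix.zero_mulVec]
  ext i j
  simpa using congrFun (h3 (Pi.single j 1)) i

/-- A matrix annihilating the controllable subspace of `(F, D)` annihilates the controllable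
subspace of `(F - D N, D)`. -/
theorem mul_pow_mul_eq_zero_of_feedback {F A : Matrix (Fin m) (Fin m) ℝ}
    {D : Matrix (Fin m) (Fin n) ℝ} {N : Matrix (Fin n) (Fin m) ℝ} (hA : A = F - D * N) (j : ℕ) :
    ∀ {Z : Matrix (Fin p) (Fin m) ℝ}, (∀ j, Z * F ^ j * D = 0) → Z * A ^ j * D = 0 := by
  induction j with
  | zero => intro Z hZ; simpa using hZ 0
  | succ j ih =>
    intro Z hZ
    rw [pow_succ', ← Matrix.mul_assoc]
    -- Since `Z D = 0`, `Z A = Z F`, which inherits the hypothesis on `Z`.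
    refine ih fun i => ?_
    have h0 : Z * D = 0 := by simpa using hZ 0
    have h1 := hZ (i + 1)
    rw [pow_succ', ← Matrix.mul_assoc] at h1
    rw [hA, Matrix.mul_sub, Matrix.sub_mul, Matrix.sub_mul, h1, ← Matrix.mul_assoc Z D N, h0]
    simp

/-- A matrix annihilating the controllability Gramian annihilates the controllable subspace. -/
theorem mul_pow_mul_eq_zero_of_gramian {F Λ : Matrix (Fin m) (Fin m) ℝ}
    {D : Matrix (Fin m) (Fin n) ℝ} (hΛs : Λᵀ = Λ) (hΛ : F * Λ + Λ * Fᵀ + D * Dᵀ = 0)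
    {Z : Matrix (Fin p) (Fin m) ℝ} (hZ : Z * Λ = 0) (j : ℕ) : Z * F ^ j * D = 0 := by
  -- Multiplying the Gramian equation by `Z` and `Zᵀ` leaves `(Z D)(Z D)ᵀ = 0`; the left annihilator
  -- of `Λ` is therefore stable under `F`.
  have key : ∀ Z : Matrix (Fin p) (Fin m) ℝ, Z * Λ = 0 → Z * D = 0 ∧ Z * F * Λ = 0 := by
    intro Z hZ
    have h1 : Z * F * Λ + Z * D * Dᵀ = 0 := by
      have := congrArg (fun N => Z * N) hΛ
      simp only [Matrix.mul_add, ← Matrix.mul_assoc, hZ, Matrix.zero_mul, add_zero,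
        Matrix.mul_zero] at this
      exact this
    have h2 : Λ * Zᵀ = 0 := by
      have := congrArg Matrix.transpose hZ
      rwa [Matrix.transpose_mul, hΛs, Matrix.transpose_zero] at this
    have h3 : Z * D * (Z * D)ᵀ = 0 := by
      have := congrArg (fun N => N * Zᵀ) h1
      simp only [Matrix.add_mul, Matrix.mul_assoc, h2, Matrix.mul_zero, zero_add,
        Matrix.zero_mul] at this
      rw [Matrix.transpose_mul, ← this]
      simp only [Matrix.mul_assoc]
    have h4 : Z * D = 0 := by
      rw [← Matrix.conjTranspose_eq_transpose_of_trivial] at h3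
      exact Matrix.self_mul_conjTranspose_eq_zero.1 h3
    rw [h4, Matrix.zero_mul, add_zero] at h1
    exact ⟨h4, h1⟩
  have hj : Z * F ^ j * Λ = 0 := by
    induction j with
    | zero => simpa using hZ
    | succ j ih =>
      rw [pow_succ, ← Matrix.mul_assoc]
      exact (key _ ih).2
  exact (key _ hj).1

end Controllability

/-! ### Stationary points and their uniqueness. -/

namespace Plant

variable {m d n l : ℕ} (S : Plant m d n l)

open scoped Matrix.Norms.Elementwise in
theorem IsGlobalMinimizer.isStationary {S : Plant m d n l} {γ : ℝ} (hγ : 0 < γ)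
    {K : Matrix (Fin d) (Fin m) ℝ} (hK : S.IsGlobalMinimizer γ K) : S.IsStationary γ K := by
  refine ⟨hK.1, (S.differentiableAt_cost hγ hK.1).1, ?_⟩
  have hmin : IsLocalMin (S.cost γ) K := by
    filter_upwards [(S.isOpen_feasible hγ).mem_nhds hK.1] with K' hK'
    exact hK.2 K' hK'
  have h0 := hmin.fderiv_eq_zero
  ext i j
  exact DFunLike.congr_fun h0 (Matrix.single i j 1)

/-- At a stationary point `R K - Bᵀ P_K` annihilates the controllable subspace. -/
theorem IsStationary.gradient_annihilates {S : Plant m d n l} {γ : ℝ} (hγ : 0 < γ)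
    {K : Matrix (Fin d) (Fin m) ℝ} (hK : S.IsStationary γ K) (j : ℕ) :
    (S.R * K - S.Bᵀ * S.riccatiSolution γ K) *
      S.worstCaseLoop γ K (S.riccatiSolution γ K) ^ j * S.D = 0 := by
  obtain ⟨-, hY⟩ := S.differentiableAt_cost hγ hK.1
  have hF := (S.isStabilizingSolution_riccatiSolution hγ hK.1).hurwitz
  set F := S.worstCaseLoop γ K (S.riccatiSolution γ K)
  set G := S.R * K - S.Bᵀ * S.riccatiSolution γ K
  have hzero : ∀ H, fderiv ℝ (S.cost γ) K H = 0 := by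
    intro H
    rw [Matrix.matrix_eq_sum_single H, map_sum]
    refine Finset.sum_eq_zero fun i _ => ?_
    rw [map_sum]
    refine Finset.sum_eq_zero fun k _ => ?_
    have h1 : Matrix.single i k (H i k) = H i k • Matrix.single i k (1 : ℝ) := by
      rw [Matrix.smul_single, smul_eq_mul, mul_one]
    have h2 : fderiv ℝ (S.cost γ) K (Matrix.single i k 1) = 0 :=
      congrFun (congrFun hK.2.2 i) k
    rw [h1, map_smul, h2, smul_zero]
  obtain ⟨Λ, hΛ⟩ := exists_lyapunov hF.transpose (S.D * S.Dᵀ)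
  have hΛs : Λᵀ = Λ := lyapunov_transpose_eq hF.transpose (by simp) hΛ
  rw [Matrix.transpose_transpose] at hΛ
  refine mul_pow_mul_eq_zero_of_gramian hΛs hΛ ?_ j
  -- In the direction `H = G Λ` the derivative of the cost is `2 tr((G Λ)ᵀ (G Λ))`.
  obtain ⟨Y, hY1, hY2⟩ := hY (G * Λ)
  rw [hzero] at hY2
  have h1 : S.D * S.Dᵀ = -(F * Λ + Λ * Fᵀ) := (neg_eq_of_add_eq_zero_right hΛ).symm
  have h2 : ((G * Λ)ᵀ * G * Λ).trace + (Gᵀ * (G * Λ) * Λ).trace = 0 := by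
    have h3 : (Y * (F * Λ + Λ * Fᵀ)).trace = ((Fᵀ * Y + Y * F) * Λ).trace := by
      rw [mul_add, add_mul, Matrix.trace_add, Matrix.trace_add, ← Matrix.mul_assoc,
        ← Matrix.mul_assoc, Matrix.trace_mul_comm (Y * Λ), ← Matrix.mul_assoc]
      ring
    rw [h1, mul_neg, Matrix.trace_neg, h3, eq_neg_of_add_eq_zero_left hY1, neg_mul,
      Matrix.trace_neg, neg_neg, add_mul, Matrix.trace_add] at hY2
    exact hY2.symm
  have h4 : (Gᵀ * (G * Λ) * Λ).trace = ((G * Λ)ᵀ * (G * Λ)).trace := by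
    rw [Matrix.trace_mul_comm, Matrix.transpose_mul, hΛs, ← Matrix.mul_assoc]
  rw [h4, Matrix.mul_assoc] at h2
  have h5 : ((G * Λ)ᴴ * (G * Λ)).trace = 0 := by
    rw [Matrix.conjTranspose_eq_transpose_of_trivial]
    linarith
  exact Matrix.trace_conjTranspose_mul_self_eq_zero_iff.1 h5

theorem IsNormalized.R_mul_cancel {S : Plant m d n l} (hS : S.IsNormalized) {ι : Type*}
    {N N' : Matrix (Fin d) ι ℝ} (h : S.R * N = S.R * N') : N = N' := by
  have hu : IsUnit S.R.det := (Matrix.isUnit_iff_isUnit_det _).1 hS.2.isUnit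
  have := congrArg (fun N => S.R⁻¹ * N) h
  simpa only [← Matrix.mul_assoc, Matrix.nonsing_inv_mul _ hu, Matrix.one_mul] using this

theorem IsNormalized.R_mul_inv_mul {S : Plant m d n l} (hS : S.IsNormalized)
    (P : Matrix (Fin m) (Fin m) ℝ) : S.R * (S.R⁻¹ * S.Bᵀ * P) = S.Bᵀ * P := by
  have hu : IsUnit S.R.det := (Matrix.isUnit_iff_isUnit_det _).1 hS.2.isUnit
  rw [← Matrix.mul_assoc, ← Matrix.mul_assoc, Matrix.mul_nonsing_inv _ hu, Matrix.one_mul]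

/-- A stationary point whose worst-case closed loop is controllable is the only stationary
point. -/
theorem IsStationary.eq_of_isControllable {S : Plant m d n l} {γ : ℝ} (hγ : 0 < γ)
    (hS : S.IsNormalized) {K K' : Matrix (Fin d) (Fin m) ℝ} (hK : S.IsStationary γ K)
    (hc : IsControllable (S.worstCaseLoop γ K (S.riccatiSolution γ K)) S.D)
    (hRK : S.R * K = S.Bᵀ * S.riccatiSolution γ K)
    (hK' : S.IsStationary γ K') : K' = K := by
  have hst := S.isStabilizingSolution_riccatiSolution hγ hK.1
  have hst' := S.isStabilizingSolution_riccatiSolution hγ hK'.1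
  have hL := hK'.gradient_annihilates hγ
  set P := S.riccatiSolution γ K
  set P' := S.riccatiSolution γ K'
  set F := S.worstCaseLoop γ K P with hFdef
  set F' := S.worstCaseLoop γ K' P' with hFdef'
  set G := S.R * K' - S.Bᵀ * P' with hG
  obtain ⟨hP0, hPr, -⟩ := S.isStabilizingSolution_iff.1 hst
  obtain ⟨hP0', hPr', -⟩ := S.isStabilizingSolution_iff.1 hst'
  have hPs := (posSemidef_real_iff.1 hP0).1
  have hPs' := (posSemidef_real_iff.1 hP0').1
  have hPB : P * S.B = Kᵀ * S.R := by
    have := congrArg Matrix.transpose hRK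
    rwa [Matrix.transpose_mul, Matrix.transpose_mul, S.R_transpose, hPs, Matrix.transpose_transpose,
      eq_comm] at this
  -- Difference of the two Riccati equations, with `F'` on one side and `F` on the other so that no
  -- quadratic term remains; `R K = Bᵀ P` leaves only the gradient factor at `K'`.
  have hX : F'ᵀ * (P' - P) + (P' - P) * F = -(Gᵀ * (K' - K)) := by
    have h1 : riccatiResidual (S.closedLoop K') (S.noise γ) (S.weight K') P' -
        riccatiResidual (S.closedLoop K) (S.noise γ) (S.weight K) P = 0 := by rw [hPr, hPr', sub_zero]
    rw [← sub_zero (F'ᵀ * (P' - P) + (P' - P) * F), ← h1, hG, hFdef, hFdef', worstCaseLoop_eq,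
      worstCaseLoop_eq, riccatiResidual, riccatiResidual, closedLoop, closedLoop, weight, weight]
    simp only [Matrix.transpose_add, Matrix.transpose_sub, Matrix.transpose_mul, S.R_transpose,
      S.noise_transpose, hPs', Matrix.transpose_transpose, Matrix.mul_add, Matrix.add_mul,
      Matrix.mul_sub, Matrix.sub_mul, Matrix.mul_assoc, ← hRK]
    simp only [← Matrix.mul_assoc, hPB]
    abel
  have hXD : ∀ j, (P' - P) * F' ^ j * S.D = 0 := by
    -- This space is invariant under the Sylvester operator and contains the right-hand side of
    -- `hX`, so it contains the solution.
    let 𝒴 : Submodule ℝ (Matrix (Fin m) (Fin m) ℝ) :=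
      { carrier := {Y | ∀ j, S.Dᵀ * F'ᵀ ^ j * Y = 0}
        zero_mem' := fun j => Matrix.mul_zero _
        add_mem' := fun ha hb j => by rw [Matrix.mul_add, ha j, hb j, add_zero]
        smul_mem' := fun c Y hY j => by rw [Matrix.mul_smul, hY j, smul_zero] }
    have h1 : P' - P ∈ 𝒴 := by
      refine mem_of_apply_mem_of_invariant (𝒱 := 𝒴) (sylvesterMap_injective hst'.hurwitz hst.hurwitz)
        (fun Y hY j => ?_) fun j => ?_
      · change S.Dᵀ * F'ᵀ ^ j * (F'ᵀ * Y + Y * F) = 0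
        have h2 := hY (j + 1)
        rw [pow_succ, ← Matrix.mul_assoc] at h2
        rw [Matrix.mul_add, ← Matrix.mul_assoc, h2, ← Matrix.mul_assoc, hY j, Matrix.zero_mul,
          add_zero]
      · change S.Dᵀ * F'ᵀ ^ j * (F'ᵀ * (P' - P) + (P' - P) * F) = 0
        have h2 := congrArg Matrix.transpose (hL j)
        rw [Matrix.transpose_mul, Matrix.transpose_mul, Matrix.transpose_pow, Matrix.transpose_zero,
          ← Matrix.mul_assoc] at h2
        rw [hX, Matrix.mul_neg, ← Matrix.mul_assoc, h2, Matrix.zero_mul, neg_zero]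
    intro j
    have h2 := congrArg Matrix.transpose (h1 j)
    rwa [Matrix.transpose_mul, Matrix.transpose_mul, Matrix.transpose_pow, Matrix.transpose_transpose,
      Matrix.transpose_transpose, Matrix.transpose_sub, hPs, hPs', Matrix.transpose_zero,
      ← Matrix.mul_assoc] at h2
  have hPw : ∀ j, P' * (F' ^ j * S.D) = P * (F' ^ j * S.D) := fun j => by
    have := hXD j
    rwa [Matrix.mul_assoc, Matrix.sub_mul, sub_eq_zero] at this
  have hKw : ∀ j, K' * (F' ^ j * S.D) = K * (F' ^ j * S.D) := fun j => by
    refine hS.R_mul_cancel ?_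
    have := hL j
    rw [Matrix.mul_assoc, Matrix.sub_mul, sub_eq_zero, Matrix.mul_assoc, Matrix.mul_assoc,
      hPw] at this
    rw [this, ← Matrix.mul_assoc, ← hRK, Matrix.mul_assoc]
  have hpow : ∀ j, F' ^ j * S.D = F ^ j * S.D := by
    intro j
    induction j with
    | zero => simp
    | succ j ih =>
      have : F' * (F' ^ j * S.D) = F * (F' ^ j * S.D) := by
        have hp := hPw j
        have hk := hKw j
        generalize F' ^ j * S.D = W at hp hk
        rw [hFdef, hFdef', worstCaseLoop_eq, worstCaseLoop_eq, closedLoop, closedLoop]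
        simp only [Matrix.add_mul, Matrix.sub_mul, Matrix.mul_assoc, hk, hp]
      rw [pow_succ', pow_succ', Matrix.mul_assoc, this, ih, Matrix.mul_assoc]
  refine sub_eq_zero.1 (hc.eq_zero fun j => ?_)
  rw [Matrix.mul_assoc, ← hpow, Matrix.sub_mul, hKw, sub_self]

end Plant

/-! ### Policy iteration from a global minimizer. -/

namespace Plant

variable {m d n l : ℕ} (S : Plant m d n l)

/-- The gains `K` and `K'` agree on the controllable subspace of `(A - B K, D)`. -/
def AgreeOnControllable (K K' : Matrix (Fin d) (Fin m) ℝ) : Prop :=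
  ∀ j : ℕ, (K' - K) * S.closedLoop K ^ j * S.D = 0

variable {S}

/-- Both loops act identically on the orbit of `D`, so the controllable subspace is the same for
both gains. -/
theorem AgreeOnControllable.pow_mul {K K' : Matrix (Fin d) (Fin m) ℝ}
    (h : S.AgreeOnControllable K K') (j : ℕ) :
    S.closedLoop K' ^ j * S.D = S.closedLoop K ^ j * S.D := by
  induction j with
  | zero => simp
  | succ j ih =>
    have h1 := h j
    rw [pow_succ', pow_succ', Matrix.mul_assoc, ih, Matrix.mul_assoc, ← sub_eq_zero,
      ← Matrix.sub_mul, closedLoop, closedLoop]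
    rw [closedLoop] at h1
    have h2 : S.A - S.B * K' - (S.A - S.B * K) = -(S.B * (K' - K)) := by
      rw [Matrix.mul_sub]
      abel
    rw [h2, Matrix.neg_mul, Matrix.mul_assoc, ← Matrix.mul_assoc (K' - K), h1, Matrix.mul_zero,
      neg_zero]

theorem AgreeOnControllable.trans {K₀ K K' : Matrix (Fin d) (Fin m) ℝ}
    (h : S.AgreeOnControllable K₀ K) (h' : S.AgreeOnControllable K K') :
    S.AgreeOnControllable K₀ K' := by
  intro j
  have h1 := h j
  have h2 := h' j
  rw [Matrix.mul_assoc] at h1 h2 ⊢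
  rw [h.pow_mul] at h2
  rw [← sub_add_sub_cancel K' K K₀, Matrix.add_mul, h1, h2, add_zero]

theorem weight_form (K : Matrix (Fin d) (Fin m) ℝ) (x : Fin m → ℝ) :
    x ⬝ᵥ S.weight K *ᵥ x = (S.C *ᵥ x) ⬝ᵥ (S.C *ᵥ x) + (K *ᵥ x) ⬝ᵥ S.R *ᵥ (K *ᵥ x) := by
  rw [weight, Matrix.add_mulVec, dotProduct_add, ← mulVec_dotProduct_self, ← mulVec_form]

/-- Feasibility depends, for stabilizing gains, only on the gain along the controllable
subspace. -/
theorem AgreeOnControllable.mem_feasible {γ : ℝ} (hγ : 0 < γ) {K K' : Matrix (Fin d) (Fin m) ℝ}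
    (h : S.AgreeOnControllable K K') (hK : K ∈ S.feasible γ) (hK' : IsHurwitz (S.closedLoop K')) :
    K' ∈ S.feasible γ := by
  obtain ⟨g, hg, hb⟩ := S.exists_frequency_le_of_mem_feasible hγ hK
  refine S.mem_feasible_of_frequency_le hγ hK' hg fun ω a b c e ha hbe => ?_
  obtain ⟨a₀, b₀, ha₀, hb₀⟩ := hK.1.exists_response S.D ω c e
  have hbound := hb ω a₀ b₀ c e ha₀ hb₀
  -- The real form of `A - B K - iω`. It is injective, preserves `𝒱`, and sends the response to `-D
  -- w`, which lies in `𝒱`; hence `K' - K` kills the response.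
  let T : (Fin m → ℝ) × (Fin m → ℝ) →ₗ[ℝ] (Fin m → ℝ) × (Fin m → ℝ) :=
    { toFun := fun v => (S.closedLoop K *ᵥ v.1 + ω • v.2, S.closedLoop K *ᵥ v.2 - ω • v.1)
      map_add' := fun v w => by
        ext i <;> simp [Matrix.mulVec_add] <;> ring
      map_smul' := fun r v => by
        ext i <;> simp [Matrix.mulVec_smul] <;> ring }
  let 𝒱 : Submodule ℝ ((Fin m → ℝ) × (Fin m → ℝ)) :=
    { carrier := {v | ∀ j : ℕ, ((K' - K) * S.closedLoop K ^ j) *ᵥ v.1 = 0 ∧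
        ((K' - K) * S.closedLoop K ^ j) *ᵥ v.2 = 0}
      zero_mem' := fun j => ⟨Matrix.mulVec_zero _, Matrix.mulVec_zero _⟩
      add_mem' := fun hv hw j => by
        simp only [Prod.fst_add, Prod.snd_add, Matrix.mulVec_add, (hv j).1, (hv j).2, (hw j).1,
          (hw j).2, add_zero, and_self]
      smul_mem' := fun r v hv j => by
        simp only [Prod.smul_fst, Prod.smul_snd, Matrix.mulVec_smul, (hv j).1, (hv j).2,
          smul_zero, and_self] }
  have hT : Function.Injective T := by
    refine (injective_iff_map_eq_zero _).2 fun v hv => ?_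
    have h1 : S.closedLoop K *ᵥ v.1 + ω • v.2 = 0 := congrArg Prod.fst hv
    have h2 : S.closedLoop K *ᵥ v.2 - ω • v.1 = 0 := congrArg Prod.snd hv
    obtain ⟨h3, h4⟩ := isHurwitz_iff.1 hK.1 0 ω v.1 v.2 le_rfl
      (by rw [eq_neg_of_add_eq_zero_left h1, zero_smul, zero_sub])
      (by rw [sub_eq_zero.1 h2, zero_smul, add_zero])
    exact Prod.ext h3 h4
  have hmem : (a₀, b₀) ∈ 𝒱 := by
    refine mem_of_apply_mem_of_invariant (𝒱 := 𝒱) hT (fun v hv j => ?_) fun j => ?_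
    · have h1 := hv (j + 1)
      rw [pow_succ, ← Matrix.mul_assoc] at h1
      have h1a := h1.1
      have h1b := h1.2
      rw [← Matrix.mulVec_mulVec] at h1a h1b
      change _ *ᵥ (S.closedLoop K *ᵥ v.1 + ω • v.2) = 0 ∧
        _ *ᵥ (S.closedLoop K *ᵥ v.2 - ω • v.1) = 0
      rw [Matrix.mulVec_add, Matrix.mulVec_sub, Matrix.mulVec_smul, Matrix.mulVec_smul, h1a, h1b,
        (hv j).1, (hv j).2]
      simp
    · change _ *ᵥ (S.closedLoop K *ᵥ a₀ + ω • b₀) = 0 ∧ _ *ᵥ (S.closedLoop K *ᵥ b₀ - ω • a₀) = 0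
      have h1 : S.closedLoop K *ᵥ a₀ + ω • b₀ = -(S.D *ᵥ c) := by
        rw [eq_sub_of_add_eq ha₀]
        abel
      have h2 : S.closedLoop K *ᵥ b₀ - ω • a₀ = -(S.D *ᵥ e) := by
        rw [eq_sub_of_add_eq hb₀]
        abel
      rw [h1, h2, Matrix.mulVec_neg, Matrix.mulVec_neg, Matrix.mulVec_mulVec,
        Matrix.mulVec_mulVec, h j]
      simp
  have hKa : K' *ᵥ a₀ = K *ᵥ a₀ := by
    have := (hmem 0).1
    rwa [pow_zero, Matrix.mul_one, Matrix.sub_mulVec, sub_eq_zero] at this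
  have hKb : K' *ᵥ b₀ = K *ᵥ b₀ := by
    have := (hmem 0).2
    rwa [pow_zero, Matrix.mul_one, Matrix.sub_mulVec, sub_eq_zero] at this
  have hcl : ∀ v, K' *ᵥ v = K *ᵥ v → S.closedLoop K' *ᵥ v = S.closedLoop K *ᵥ v := by
    intro v hv
    rw [closedLoop, closedLoop, Matrix.sub_mulVec, Matrix.sub_mulVec, ← Matrix.mulVec_mulVec,
      ← Matrix.mulVec_mulVec, hv]
  -- The two responses to one disturbance differ by an undriven oscillation, hence coincide.
  obtain ⟨h1, h2⟩ := isHurwitz_iff.1 hK' 0 ω (a - a₀) (b - b₀) le_rfl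
    (by
      rw [Matrix.mulVec_sub, hcl a₀ hKa, eq_sub_of_add_eq ha, eq_sub_of_add_eq ha₀]
      simp only [zero_smul, zero_sub, smul_sub]
      abel)
    (by
      rw [Matrix.mulVec_sub, hcl b₀ hKb, eq_sub_of_add_eq hbe, eq_sub_of_add_eq hb₀, smul_sub]
      simp)
  rw [sub_eq_zero.1 h1, sub_eq_zero.1 h2, weight_form, weight_form, hKa, hKb, ← weight_form,
    ← weight_form]
  exact hbound

/-- Detectability makes the closed loop of every positive semidefinite solution of the Lyapunov
inequality Hurwitz. -/
theorem isHurwitz_closedLoop_of_lyapunov (hS : S.IsNormalized) (hdet : IsDetectable S.A S.C)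
    {K : Matrix (Fin d) (Fin m) ℝ} {P Q : Matrix (Fin m) (Fin m) ℝ} (hP : P.PosSemidef)
    (hQ : ∀ x, 0 ≤ x ⬝ᵥ Q *ᵥ x)
    (h : (S.closedLoop K)ᵀ * P + P * S.closedLoop K + S.weight K + Q = 0) :
    IsHurwitz (S.closedLoop K) := by
  obtain ⟨L, hL⟩ := hdet
  have hR := (posDef_real_iff.1 hS.2).2
  have hW := fun x => (posSemidef_real_iff.1 (S.weight_posSemidef K)).2 x
  -- Where the weight vanishes, `C x = 0` and, as `R > 0`, `K x = 0`: both matrices act as `A`.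
  have hkey : ∀ x, x ⬝ᵥ (S.weight K + Q) *ᵥ x = 0 →
      (S.A + L * S.C) *ᵥ x = S.closedLoop K *ᵥ x := by
    intro x hx
    rw [Matrix.add_mulVec, dotProduct_add] at hx
    have h1 : x ⬝ᵥ S.weight K *ᵥ x = 0 := by linarith [hW x, hQ x]
    rw [weight_form] at h1
    have h2 : 0 ≤ (S.C *ᵥ x) ⬝ᵥ (S.C *ᵥ x) := Finset.sum_nonneg fun i _ => mul_self_nonneg _
    have h3 := (posSemidef_real_iff.1 S.R_posSemidef).2 (K *ᵥ x)
    have hC : S.C *ᵥ x = 0 := dotProduct_self_eq_zero.1 (by linarith)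
    have hK : K *ᵥ x = 0 := by
      by_contra h0
      linarith [hR _ h0]
    rw [closedLoop, Matrix.add_mulVec, Matrix.sub_mulVec, ← Matrix.mulVec_mulVec,
      ← Matrix.mulVec_mulVec, hC, hK, Matrix.mulVec_zero, Matrix.mulVec_zero, add_zero, sub_zero]
  refine isHurwitz_of_lyapunov hP (Q := S.weight K + Q) (fun x => ?_) (by rw [← add_assoc, h])
    fun α β a b hα ha hb ha0 hb0 =>
      isHurwitz_iff.1 hL α β a b hα (by rw [hkey a ha0, ha]) (by rw [hkey b hb0, hb])
  rw [Matrix.add_mulVec, dotProduct_add]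
  exact add_nonneg (hW x) (hQ x)

/-- Completion of the square in the gain, whose minimum is at `R K' = Bᵀ P`. -/
theorem riccatiResidual_improve {K K' : Matrix (Fin d) (Fin m) ℝ} {P T : Matrix (Fin m) (Fin m) ℝ}
    (hP : Pᵀ = P) (hK' : S.R * K' = S.Bᵀ * P) :
    riccatiResidual (S.closedLoop K') T (S.weight K') P + (K - K')ᵀ * S.R * (K - K') =
      riccatiResidual (S.closedLoop K) T (S.weight K) P := by
  have hPB : P * S.B = K'ᵀ * S.R := by
    have := congrArg Matrix.transpose hK'
    rwa [Matrix.transpose_mul, Matrix.transpose_mul, S.R_transpose, hP, Matrix.transpose_transpose,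
      eq_comm] at this
  rw [riccatiResidual, riccatiResidual, closedLoop, closedLoop, weight, weight]
  simp only [Matrix.transpose_sub, Matrix.transpose_mul, Matrix.mul_sub, Matrix.sub_mul,
    Matrix.mul_assoc, ← hK']
  simp only [← Matrix.mul_assoc, hPB]
  abel

theorem trace_mul_noise_nonneg {X : Matrix (Fin m) (Fin m) ℝ} (hX : X.PosSemidef) :
    0 ≤ (X * (S.D * S.Dᵀ)).trace := by
  rw [← Matrix.mul_assoc, Matrix.trace_mul_comm, ← Matrix.mul_assoc,
    ← Matrix.conjTranspose_eq_transpose_of_trivial]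
  exact (hX.conjTranspose_mul_mul_same S.D).trace_nonneg

theorem mul_disturbance_eq_zero {X : Matrix (Fin m) (Fin m) ℝ} (hX : X.PosSemidef)
    (h : (X * (S.D * S.Dᵀ)).trace = 0) : X * S.D = 0 := by
  rw [← Matrix.mul_assoc, Matrix.trace_mul_comm, ← Matrix.mul_assoc,
    ← Matrix.conjTranspose_eq_transpose_of_trivial] at h
  have h1 := (hX.conjTranspose_mul_mul_same S.D).trace_eq_zero_iff.1 h
  rw [Matrix.conjTranspose_eq_transpose_of_trivial] at h1
  ext i j
  have h2 := mulVec_eq_zero_of_form_eq_zero hX (x := S.D *ᵥ Pi.single j 1) (by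
    rw [mulVec_form, h1, Matrix.zero_mulVec, dotProduct_zero])
  rw [Matrix.mulVec_mulVec] at h2
  simpa using congrFun h2 i

/-- One step of policy iteration from a global minimizer. -/
theorem IsGlobalMinimizer.improve {γ : ℝ} (hγ : 0 < γ) (hS : S.IsNormalized)
    (hdet : IsDetectable S.A S.C) {K K' : Matrix (Fin d) (Fin m) ℝ} (hK : S.IsGlobalMinimizer γ K)
    (hK' : S.R * K' = S.Bᵀ * S.riccatiSolution γ K) :
    S.AgreeOnControllable K K' ∧ S.IsGlobalMinimizer γ K' ∧
      (S.riccatiSolution γ K - S.riccatiSolution γ K').PosSemidef := by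
  have hst := S.isStabilizingSolution_riccatiSolution hγ hK.1
  have hgrad := (hK.isStationary hγ).gradient_annihilates hγ
  obtain ⟨hP0, hPr, -⟩ := S.isStabilizingSolution_iff.1 hst
  have hP := (posSemidef_real_iff.1 hP0).1
  have hag : S.AgreeOnControllable K K' := by
    intro j
    -- Stationarity concerns the worst-case loop, agreement the closed loop; they differ by feedback
    -- through `D`.
    refine mul_pow_mul_eq_zero_of_feedback (F := S.worstCaseLoop γ K (S.riccatiSolution γ K))
      (N := (γ⁻¹ ^ 2) • (S.Dᵀ * S.riccatiSolution γ K)) ?_ j fun i => ?_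
    · rw [worstCaseLoop, Matrix.mul_smul, ← Matrix.mul_assoc, add_sub_cancel_right]
    · refine hS.R_mul_cancel ?_
      have := hgrad i
      rw [← hK', ← Matrix.mul_sub, Matrix.mul_assoc, Matrix.mul_assoc] at this
      rw [← neg_sub K K', Matrix.neg_mul, Matrix.neg_mul, Matrix.mul_neg, Matrix.mul_assoc (K - K'),
        this, neg_zero, Matrix.mul_zero]
  set P := S.riccatiSolution γ K with hPdef
  have himp := riccatiResidual_improve (K := K) (T := S.noise γ) hP hK'
  rw [hPr] at himp
  have hQ : ∀ x, 0 ≤ x ⬝ᵥ ((K - K')ᵀ * S.R * (K - K')) *ᵥ x := fun x => by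
    rw [← mulVec_form]
    exact (posSemidef_real_iff.1 S.R_posSemidef).2 _
  have hH : IsHurwitz (S.closedLoop K') := by
    refine isHurwitz_closedLoop_of_lyapunov hS hdet hP0
      (Q := P * S.noise γ * P + (K - K')ᵀ * S.R * (K - K')) (fun x => ?_) ?_
    · rw [Matrix.add_mulVec, dotProduct_add]
      exact add_nonneg (form_mul_mul_nonneg (S.noise_posSemidef γ) hP x) (hQ x)
    · rw [← himp, riccatiResidual, add_assoc _ (P * S.noise γ * P)]
  have hfeas := hag.mem_feasible hγ hK.1 hH
  obtain ⟨hN0, hNr, hNF⟩ :=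
    S.isStabilizingSolution_iff.1 (S.isStabilizingSolution_riccatiSolution hγ hfeas)
  have hN := (posSemidef_real_iff.1 hN0).1
  have hdiff : (P - S.riccatiSolution γ K').PosSemidef :=
    posSemidef_real_iff.2 ⟨by rw [Matrix.transpose_sub, hP, hN],
      riccati_comparison (S.noise_posSemidef γ) hP hN hNr hNF hQ himp⟩
  refine ⟨hag, ⟨hfeas, fun K'' hK'' => le_trans ?_ (hK.2 K'' hK'')⟩, hdiff⟩
  have := S.trace_mul_noise_nonneg hdiff
  rw [Matrix.sub_mul, Matrix.trace_sub, ← Matrix.mul_assoc, ← Matrix.mul_assoc] at this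
  rw [cost, cost, ← hPdef]
  linarith

/-- Policy iteration from a global minimizer converges to a global minimizer which is a fixed
point. -/
theorem IsGlobalMinimizer.exists_fixed_point {γ : ℝ} (hγ : 0 < γ) (hS : S.IsNormalized)
    (hdet : IsDetectable S.A S.C) {K₀ : Matrix (Fin d) (Fin m) ℝ}
    (hK₀ : S.IsGlobalMinimizer γ K₀) :
    ∃ K, S.IsGlobalMinimizer γ K ∧ K = S.R⁻¹ * S.Bᵀ * S.riccatiSolution γ K := by
  let step : {K // S.IsGlobalMinimizer γ K} → {K // S.IsGlobalMinimizer γ K} := fun K =>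
    ⟨S.R⁻¹ * S.Bᵀ * S.riccatiSolution γ K.1, (K.2.improve hγ hS hdet (hS.R_mul_inv_mul _)).2.1⟩
  let K : ℕ → {K // S.IsGlobalMinimizer γ K} := fun k => step^[k] ⟨K₀, hK₀⟩
  have hKs : ∀ k, (K (k + 1)).1 = S.R⁻¹ * S.Bᵀ * S.riccatiSolution γ (K k).1 := fun k =>
    congrArg Subtype.val (Function.iterate_succ_apply' step k _)
  have himp := fun k => (K k).2.improve hγ hS hdet (K' := (K (k + 1)).1)
    (by rw [hKs]; exact hS.R_mul_inv_mul _)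
  have hag : ∀ k, S.AgreeOnControllable K₀ (K k).1 := by
    intro k
    induction k with
    | zero => intro j; simp [K]
    | succ k ih => exact ih.trans (himp k).1
  set P : ℕ → Matrix (Fin m) (Fin m) ℝ := fun k => S.riccatiSolution γ (K k).1 with hPdef
  have hst : ∀ k, _ := fun k => S.isStabilizingSolution_iff.1
    (S.isStabilizingSolution_riccatiSolution hγ (K k).2.1)
  have hPs : ∀ k, (P k)ᵀ = P k := fun k => (posSemidef_real_iff.1 (hst k).1).1
  -- The solutions decrease and are nonnegative, so their negatives increase below `0`.
  obtain ⟨L', hL'⟩ := exists_tendsto_of_monotone_form (P := fun k => -P k) (B := 0)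
    (fun k => by rw [Matrix.transpose_neg, hPs])
    (fun k x => by
      have := (posSemidef_real_iff.1 (himp k).2.2).2 x
      rw [Matrix.sub_mulVec, dotProduct_sub] at this
      simp only [Matrix.neg_mulVec, dotProduct_neg]
      linarith)
    (fun k x => by
      have := (posSemidef_real_iff.1 (hst k).1).2 x
      simp only [Matrix.neg_mulVec, dotProduct_neg, Matrix.zero_mulVec, dotProduct_zero]
      linarith)
  obtain ⟨L, hL⟩ : ∃ L, Filter.Tendsto P Filter.atTop (nhds L) :=
    ⟨-L', by simpa using hL'.neg⟩
  set K' := S.R⁻¹ * S.Bᵀ * L with hK'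
  have hKL : Filter.Tendsto (fun k => (K k).1) Filter.atTop (nhds K') := by
    rw [← Filter.tendsto_add_atTop_iff_nat 1]
    simp only [hKs]
    have hc : Continuous fun N : Matrix (Fin m) (Fin m) ℝ => S.R⁻¹ * S.Bᵀ * N := by fun_prop
    exact (hc.tendsto L).comp hL
  -- Strict feasibility need not survive a limit, but agreement with the feasible `K₀` is a closed
  -- condition.
  have hag' : S.AgreeOnControllable K₀ K' := by
    intro j
    have hc : Continuous fun N : Matrix (Fin d) (Fin m) ℝ =>
        (N - K₀) * S.closedLoop K₀ ^ j * S.D := by fun_prop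
    exact tendsto_nhds_unique ((hc.tendsto K').comp hKL)
      ((tendsto_const_nhds (x := (0 : Matrix (Fin d) (Fin n) ℝ))).congr fun k => (hag k j).symm)
  have hL0 : L.PosSemidef := by
    refine posSemidef_real_iff.2 ⟨?_, fun x => ?_⟩
    · have hc : Continuous fun N : Matrix (Fin m) (Fin m) ℝ => Nᵀ := by fun_prop
      exact tendsto_nhds_unique ((hc.tendsto L).comp hL) (hL.congr fun k => (hPs k).symm)
    · have hc : Continuous fun N : Matrix (Fin m) (Fin m) ℝ => x ⬝ᵥ N *ᵥ x := by fun_prop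
      exact ge_of_tendsto' ((hc.tendsto L).comp hL) fun k =>
        (posSemidef_real_iff.1 (hst k).1).2 x
  have hLs := (posSemidef_real_iff.1 hL0).1
  have hLr : riccatiResidual (S.closedLoop K') (S.noise γ) (S.weight K') L = 0 := by
    have hc : Continuous fun p : Matrix (Fin d) (Fin m) ℝ × Matrix (Fin m) (Fin m) ℝ =>
        riccatiResidual (S.closedLoop p.1) (S.noise γ) (S.weight p.1) p.2 := by
      have h1 := S.continuous_closedLoop
      have h2 := S.continuous_weight
      unfold riccatiResidual
      fun_prop
    exact tendsto_nhds_unique ((hc.tendsto (K', L)).comp (hKL.prodMk_nhds hL))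
      ((tendsto_const_nhds (x := (0 : Matrix (Fin m) (Fin m) ℝ))).congr fun k => (hst k).2.1.symm)
  have hH : IsHurwitz (S.closedLoop K') :=
    isHurwitz_closedLoop_of_lyapunov hS hdet hL0
      (form_mul_mul_nonneg (S.noise_posSemidef γ) hLs) hLr
  have hfeas := hag'.mem_feasible hγ hK₀.1 hH
  obtain ⟨hN0, hNr, hNF⟩ :=
    S.isStabilizingSolution_iff.1 (S.isStabilizingSolution_riccatiSolution hγ hfeas)
  have hN := (posSemidef_real_iff.1 hN0).1
  set N := S.riccatiSolution γ K' with hNdef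
  have hdiff : (L - N).PosSemidef :=
    posSemidef_real_iff.2 ⟨by rw [Matrix.transpose_sub, hLs, hN],
      riccati_comparison (S.noise_posSemidef γ) hLs hN hNr hNF (Q := 0) (by simp)
        (by rw [hLr, add_zero])⟩
  have hLcost : (L * (S.D * S.Dᵀ)).trace = S.cost γ K₀ := by
    have hc : Continuous fun N : Matrix (Fin m) (Fin m) ℝ => (N * (S.D * S.Dᵀ)).trace := by fun_prop
    refine tendsto_nhds_unique ((hc.tendsto L).comp hL) (tendsto_const_nhds.congr fun k => ?_)
    have h1 : S.cost γ K₀ = S.cost γ (K k).1 :=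
      le_antisymm (hK₀.2 _ (K k).2.1) ((K k).2.2 _ hK₀.1)
    rw [h1, cost, Matrix.mul_assoc]
    rfl
  have hcost : S.cost γ K' = (N * (S.D * S.Dᵀ)).trace := by rw [cost, Matrix.mul_assoc]
  have hle := hK₀.2 K' hfeas
  have hnn := S.trace_mul_noise_nonneg hdiff
  rw [Matrix.sub_mul, Matrix.trace_sub] at hnn
  -- `L` carries the minimal cost and `L ≥ N`, so minimality forces equality of the traces.
  have hXD : (L - N) * S.D = 0 := S.mul_disturbance_eq_zero hdiff (by
    rw [Matrix.sub_mul, Matrix.trace_sub]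
    linarith)
  -- With `(L - N) D = 0` the quadratic term drops, leaving a homogeneous Lyapunov equation in the
  -- Hurwitz loop of `N`.
  have hLN : L = N := by
    have h1 := riccatiResidual_sub (A := S.closedLoop K') (M := S.weight K') (P := L)
      (S.noise_transpose γ) hN
    rw [hLr, hNr, sub_zero] at h1
    have h2 : (L - N) * S.noise γ = 0 := by
      rw [noise, Matrix.mul_smul, ← Matrix.mul_assoc, hXD, Matrix.zero_mul, smul_zero]
    rw [h2, Matrix.zero_mul, add_zero] at h1
    exact sub_eq_zero.1 (sylvester_eq_zero hNF hNF h1)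
  refine ⟨K', ⟨hfeas, fun K'' hK'' => le_trans ?_ (hK₀.2 K'' hK'')⟩, by rw [← hNdef, ← hLN]⟩
  linarith

end Plant

end MixedDesign

end

theorem propositionA1 {m d n l : ℕ} (S : MixedDesign.Plant m d n l) (γ : ℝ) (hγ : 0 < γ)
    (hS : S.IsNormalized) (hdet : MixedDesign.IsDetectable S.A S.C)
    (hopt : ∃ K, S.IsGlobalMinimizer γ K) :
    -- the cost is differentiable on the feasible set
    (∀ K ∈ S.feasible γ, DifferentiableAt ℝ (S.cost γ) K) ∧
    -- some global minimizer has the form `R⁻¹ Bᵀ P_K`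
    (∃ K, S.IsGlobalMinimizer γ K ∧ K = S.R⁻¹ * S.Bᵀ * S.riccatiSolution γ K) ∧
    -- a controllable stationary point is the unique one and the unique global minimizer
    (∀ K, S.IsStationary γ K →
      MixedDesign.IsControllable (S.worstCaseLoop γ K (S.riccatiSolution γ K)) S.D →
        (∀ K', S.IsStationary γ K' → K' = K) ∧
        S.IsGlobalMinimizer γ K ∧ (∀ K', S.IsGlobalMinimizer γ K' → K' = K) ∧
        K = S.R⁻¹ * S.Bᵀ * S.riccatiSolution γ K) := by
  obtain ⟨K₀, hK₀⟩ := hopt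
  refine ⟨fun K hK => (S.differentiableAt_cost hγ hK).1, hK₀.exists_fixed_point hγ hS hdet,
    fun K hK hc => ?_⟩
  have hRK : S.R * K = S.Bᵀ * S.riccatiSolution γ K :=
    sub_eq_zero.1 (hc.eq_zero (hK.gradient_annihilates hγ))
  have huniq : ∀ K', S.IsStationary γ K' → K' = K := fun K' hK' =>
    hK.eq_of_isControllable hγ hS hc hRK hK'
  have hmin : ∀ K', S.IsGlobalMinimizer γ K' → K' = K := fun K' hK' =>
    huniq K' (hK'.isStationary hγ)
  exact ⟨huniq, hmin K₀ hK₀ ▸ hK₀, hmin,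
    hS.R_mul_cancel (hRK.trans (hS.R_mul_inv_mul _).symm)⟩
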